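/- Let $f:\mathbb{C}\to\mathbb{C}$ be a transcendental entire function, that is, an entire function which is not a polynomial, and let $f^n$ denote its $n$-th iterate. Let $F(f)$ be the Fatou set of $f$, i.e. the set of $z\in\mathbb{C}$ having a neighbourhood on which $(f^n)_{n\in\mathbb{N}}$ is a normal family (every sequence of its members has a subsequence converging locally uniformly to a finite function or to $\infty$, the neighbourhood being taken connected and open), and let $J(f)=\mathbb{C}\setminus F(f)$ be the Julia set. For $r>0$ put $M(r,f)=\max_{|z|=r}|f(z)|$ and let $M^n(r,f)$ denote the $n$-th iterate of $r\mapsto M(r,f)$. There exist $R>0$ such that $M(r,f)>r$ for all $r\ge R$. For any such $R$, the fast escaping set $$A(f)=\{z\in\mathbb{C}:\ \text{there exists } L\in\mathbb{N}\text{ such that } |f^{n+L}(z)|\ge M^n(R,f)\text{ for all } n\in\mathbb{N}\}$$ satisfies: (a) $A(f)\cap J(f)\neq\emptyset$; (b) $J(f)=\partial A(f)$; (c) $J(f)=\overline{A(f)\cap J(f)}$. -/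

import Mathlib

open Filter Topology

namespace EntireDynamics

/-- A transcendental entire function: holomorphic on all of `ℂ` and not a polynomial. -/
def IsTranscendentalEntire (f : ℂ → ℂ) : Prop :=
  Differentiable ℂ f ∧ ¬ ∃ p : Polynomial ℂ, ∀ z, f z = p.eval z

/-- Normality (in the extended sense) of a family `F` of holomorphic functions on a domain
`U ⊆ ℂ`: every sequence in `F` has a subsequence that converges locally uniformly on `U`, either
to a finite function or to the constant `∞`. For functions holomorphic on a connected open set
this is sequential compactness for the spherical metric. -/
def IsNormalFamilyOn (F : Set (ℂ → ℂ)) (U : Set ℂ) : Prop :=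
  ∀ g : ℕ → ℂ → ℂ, (∀ k, g k ∈ F) →
    ∃ φ : ℕ → ℕ, StrictMono φ ∧
      ((∃ h : ℂ → ℂ, TendstoLocallyUniformlyOn (fun k => g (φ k)) h atTop U) ∨
        ∀ K ⊆ U, IsCompact K → ∀ C : ℝ, ∀ᶠ k in atTop, ∀ z ∈ K, C ≤ ‖g (φ k) z‖)

/-- The Fatou set: the points having a neighbourhood (which may be taken to be a domain) on which
the iterates of `f` form a normal family. -/
def fatouSet (f : ℂ → ℂ) : Set ℂ :=
  {z | ∃ U : Set ℂ, IsOpen U ∧ IsConnected U ∧ z ∈ U ∧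
    IsNormalFamilyOn (Set.range fun n : ℕ => f^[n]) U}

/-- The Julia set. -/
def juliaSet (f : ℂ → ℂ) : Set ℂ := (fatouSet f)ᶜ

/-- The maximum modulus `M(r, f) = max_{|z| = r} |f z|`; for `f` continuous and `r ≥ 0` the
supremum is attained. -/
noncomputable def maxModulus (f : ℂ → ℂ) (r : ℝ) : ℝ :=
  sSup ((fun z => ‖f z‖) '' Metric.sphere (0 : ℂ) r)

/-- The radii `R` allowed in the definition of the fast escaping set. -/
def IsAdmissibleRadius (f : ℂ → ℂ) (R : ℝ) : Prop :=
  0 < R ∧ ∀ r, R ≤ r → r < maxModulus f r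

/-- The fast escaping set `A(f)`, computed from the radius `R`: the points `z` such that, for some
`L`, `|f^{n+L}(z)| ≥ M^n(R, f)` for all `n`, where `M^n` is the `n`-th iterate of `r ↦ M(r, f)`. -/
def fastEscapingSet (f : ℂ → ℂ) (R : ℝ) : Set ℂ :=
  {z | ∃ L : ℕ, ∀ n : ℕ, (maxModulus f)^[n] R ≤ ‖f^[n + L] z‖}

end EntireDynamics

namespace EntireDynamics

open Metric Set

/-! The proof has three ingredients: a fast escaping point of J(f), complete invariance of A(f) and
J(f), and Montel's theorem. A fast escaping point `p` is not fixed, so `p` and `f p` are distinct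
points of A(f) ∩ J(f). The iterates of any disc centred in J(f) hit one of the two at arbitrarily
late times, which makes A(f) ∩ J(f) dense in J(f).

For the boundary, J(f) misses the interior of A(f): otherwise, by Baire, a single `L` would serve on
a relatively open piece of J(f), although points of that piece return to {`p`, `f p`} arbitrarily
late. Conversely, A(f) is locally all or nothing on the Fatou set: by Harnack, neighbouring escaping
orbits have moduli comparable up to a cube, and one more iterate absorbs the cube because M(r) ≥ r³
for large r.

Existence comes from Schottky's theorem and M(κr)/M(r) → ∞ for κ > 1: `f` maps each large annulus r
≤ |z| ≤ 8r over another with inner radius at least M(r). An orbit following such a tower escapes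
fast. If every annulus meets J(f), the orbit can be kept in J(f). Otherwise, far enough up the
tower, consecutive orbit points lie in different Fatou components, and a boundary point of the
component of the starting point is fast escaping. -/

/-! ### Bloch's theorem -/

/-- By the Schwarz lemma applied to `deriv h`, the derivative varies by at most half its central
size on the disc of radius r/6. There `h` is nearly affine, hence moves the bounding circle at least
Kr/6 - Kr/12 away from `h a`; the quantitative open mapping theorem keeps half of this. -/
theorem ball_subset_image_of_norm_deriv_le {h : ℂ → ℂ} {a : ℂ} {r : ℝ} (hr : 0 < r)
    (hd : DifferentiableOn ℂ h (ball a r)) (h0 : deriv h a ≠ 0)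
    (hb : ∀ z ∈ ball a r, ‖deriv h z‖ ≤ 2 * ‖deriv h a‖) :
    ball (h a) (‖deriv h a‖ * r / 24) ⊆ h '' ball a r := by
  set K := ‖deriv h a‖ with hK
  have hKpos : 0 < K := norm_pos_iff.mpr h0
  have hda : DifferentiableAt ℂ h a := hd.differentiableAt (isOpen_ball.mem_nhds (mem_ball_self hr))
  have hd' : DifferentiableOn ℂ (deriv h) (ball a r) := hd.deriv isOpen_ball
  have hclose : ∀ z ∈ closedBall a (r / 6), ‖deriv h z - deriv h a‖ ≤ K / 2 := by
    intro z hz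
    have hz' : z ∈ ball a r := closedBall_subset_ball (by linarith) hz
    have := Complex.dist_le_div_mul_dist_of_mapsTo_ball (R₂ := 3 * K) hd' (fun w hw => by
      rw [mem_closedBall, dist_eq_norm]
      linarith [norm_sub_le (deriv h w) (deriv h a), hb w hw]) hz'
    rw [dist_eq_norm] at this
    rw [mem_closedBall] at hz
    calc _ ≤ 3 * K / r * dist z a := this
      _ ≤ 3 * K / r * (r / 6) := by gcongr
      _ = K / 2 := by field_simp; norm_num
  have hsub : closedBall a (r / 6) ⊆ ball a r := closedBall_subset_ball (by linarith)
  have hlow : ∀ z ∈ sphere a (r / 6), K * r / 12 ≤ ‖h z - h a‖ := by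
    intro z hz
    have hzc := sphere_subset_closedBall hz
    have hac : a ∈ closedBall a (r / 6) := mem_closedBall_self (by linarith)
    have hmv := (convex_closedBall a (r / 6)).norm_image_sub_le_of_norm_hasDerivWithin_le
      (f := fun z => h z - deriv h a * z) (f' := fun z => deriv h z - deriv h a) (C := K / 2)
      (fun w hw => (((hd.differentiableAt (isOpen_ball.mem_nhds (hsub hw))).hasDerivAt).sub
        (by simpa using (hasDerivAt_id w).const_mul (deriv h a))).hasDerivWithinAt) hclose hac hzc
    have e : h z - deriv h a * z - (h a - deriv h a * a) = (h z - h a) - deriv h a * (z - a) := by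
      ring
    have hn : ‖z - a‖ = r / 6 := by simpa [dist_eq_norm] using hz
    simp only [e, hn] at hmv
    have h3 : ‖deriv h a * (z - a)‖ = K * (r / 6) := by rw [norm_mul, hn]
    have h4 := norm_sub_norm_le (deriv h a * (z - a)) (h z - h a)
    rw [norm_sub_rev _ (h z - h a)] at h4
    nlinarith
  have := DiffContOnCl.ball_subset_image_closedBall
    (hd.diffContOnCl_ball hsub) (by linarith) hlow
    (Eventually.frequently (f := 𝓝[≠] a) (hda.hasDerivAt.eventually_ne h0) |>.filter_mono
      nhdsWithin_le_nhds)
  refine subset_trans ?_ (this.trans (image_mono hsub))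
  exact ball_subset_ball (by linarith)

/-- A form of Bloch's theorem: a holomorphic function whose image of a disc contains no disc of
radius `1` has a controlled derivative at the centre. -/
theorem norm_deriv_mul_le_of_no_unit_ball {h : ℂ → ℂ} {c : ℂ} {ρ : ℝ} (hρ : 0 < ρ)
    (hd : DifferentiableOn ℂ h (ball c ρ)) (hno : ∀ w, ¬ ball w 1 ⊆ h '' ball c ρ) :
    ‖deriv h c‖ * ρ ≤ 96 := by
  have hd' : DifferentiableOn ℂ (deriv h) (ball c ρ) := hd.deriv isOpen_ball
  have hsub : closedBall c (ρ / 2) ⊆ ball c ρ := closedBall_subset_ball (by linarith)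
  -- Landau's device: at a maximum of this weighted derivative, |h'| at most doubles on the disc of
  -- half the remaining radius. The bound 96 is 4 · 24: one factor 2 from ρ/2, one from the halved
  -- radius.
  obtain ⟨a, ha, hmax⟩ := (isCompact_closedBall c (ρ / 2)).exists_isMaxOn
    (f := fun z => ‖deriv h z‖ * (ρ / 2 - dist z c)) ⟨c, mem_closedBall_self (by linarith)⟩
    (((hd'.continuousOn.mono hsub).norm).mul (by fun_prop))
  have hmax' : ∀ z ∈ closedBall c (ρ / 2), ‖deriv h z‖ * (ρ / 2 - dist z c) ≤
      ‖deriv h a‖ * (ρ / 2 - dist a c) := fun z hz => hmax hz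
  have hc := hmax' c (mem_closedBall_self (by linarith))
  rw [dist_self, sub_zero] at hc
  by_contra! hlt
  have hac : dist a c ≤ ρ / 2 := ha
  have hpos : 48 < ‖deriv h a‖ * (ρ / 2 - dist a c) := by linarith
  set r := (ρ / 2 - dist a c) / 2 with hr
  have hr0 : 0 < r := by
    rcases lt_or_ge 0 r with hr0 | hr0
    · exact hr0
    · nlinarith [norm_nonneg (deriv h a)]
  have hball : ball a r ⊆ closedBall c (ρ / 2) := fun z hz => by
    rw [mem_closedBall]; rw [mem_ball] at hz
    linarith [dist_triangle z a c]
  have h0 : deriv h a ≠ 0 := fun h => by rw [h] at hpos; simp at hpos; linarith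
  refine hno (h a) ?_
  refine subset_trans ?_ ((ball_subset_image_of_norm_deriv_le hr0
    (hd.mono (hball.trans hsub)) h0 fun z hz => ?_).trans (image_mono (hball.trans hsub)))
  · refine ball_subset_ball ?_
    rw [le_div_iff₀ (by norm_num)]
    nlinarith
  · have h1 := hmax' z (hball hz)
    have h2 : r ≤ ρ / 2 - dist z c := by
      rw [mem_ball] at hz
      linarith [dist_triangle z a c]
    have h3 : ‖deriv h z‖ * r ≤ 2 * ‖deriv h a‖ * r := by
      calc ‖deriv h z‖ * r ≤ ‖deriv h z‖ * (ρ / 2 - dist z c) := by gcongr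
        _ ≤ _ := h1
        _ = _ := by rw [hr]; ring
    exact le_of_mul_le_mul_right h3 hr0

theorem norm_sub_le_of_no_unit_ball {h : ℂ → ℂ} {c : ℂ} {ρ : ℝ} (hρ : 0 < ρ)
    (hd : DifferentiableOn ℂ h (ball c ρ)) (hno : ∀ w, ¬ ball w 1 ⊆ h '' ball c ρ)
    {z : ℂ} (hz : z ∈ ball c (ρ / 2)) : ‖h z - h c‖ ≤ 96 := by
  have hsub : ball c (ρ / 2) ⊆ ball c ρ := ball_subset_ball (by linarith)
  have hb : ∀ w ∈ ball c (ρ / 2), ‖deriv h w‖ ≤ 192 / ρ := by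
    intro w hw
    have hs : ball w (ρ / 2) ⊆ ball c ρ := ball_subset (by rw [mem_ball] at hw; linarith)
    have := norm_deriv_mul_le_of_no_unit_ball (by linarith) (hd.mono hs)
      fun v hv => hno v (hv.trans (image_mono hs))
    rw [le_div_iff₀ hρ]; linarith
  have := (convex_ball c (ρ / 2)).norm_image_sub_le_of_norm_deriv_le
    (fun w hw => hd.differentiableAt (isOpen_ball.mem_nhds (hsub hw))) hb
    (mem_ball_self (by linarith)) hz
  calc _ ≤ 192 / ρ * ‖z - c‖ := this
    _ ≤ 192 / ρ * (ρ / 2) := by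
      gcongr; rw [mem_ball, dist_eq_norm] at hz; exact hz.le
    _ = 96 := by field_simp; norm_num

/-! ### Holomorphic logarithms and arccosines; Schottky's theorem -/

theorem exists_exp_eq_on_ball {g : ℂ → ℂ} {c : ℂ} {ρ : ℝ}
    (hg : DifferentiableOn ℂ g (ball c ρ)) (h0 : ∀ z ∈ ball c ρ, g z ≠ 0) :
    ∃ L : ℂ → ℂ, DifferentiableOn ℂ L (ball c ρ) ∧ ∀ z ∈ ball c ρ, Complex.exp (L z) = g z := by
  rcases le_or_gt ρ 0 with hρ | hρ
  · exact ⟨0, by simp [ball_eq_empty.mpr hρ], by simp [ball_eq_empty.mpr hρ]⟩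
  have hd : DifferentiableOn ℂ (fun z => deriv g z / g z) (ball c ρ) :=
    (hg.deriv isOpen_ball).div hg h0
  obtain ⟨L, hL⟩ := hd.isExactOn_ball.with_val_at c (Complex.log (g c))
  have hc : c ∈ ball c ρ := mem_ball_self hρ
  have hLd : ∀ z ∈ ball c ρ, HasDerivAt L (deriv g z / g z) z := hL.2
  have hder : ∀ z ∈ ball c ρ, HasDerivAt (fun z => g z * Complex.exp (-L z)) 0 z := by
    intro z hz
    have h1 := (hg.differentiableAt (isOpen_ball.mem_nhds hz)).hasDerivAt
    refine (h1.mul (hLd z hz).neg.cexp).congr_deriv ?_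
    have := h0 z hz
    field_simp
    ring
  refine ⟨L, fun z hz => (hLd z hz).differentiableAt.differentiableWithinAt, fun z hz => ?_⟩
  have hconst := (convex_ball c ρ).is_const_of_fderivWithin_eq_zero (𝕜 := ℂ)
    (f := fun z => g z * Complex.exp (-L z))
    (fun w hw => (hder w hw).differentiableAt.differentiableWithinAt)
    (fun w hw => by
      rw [fderivWithin_of_isOpen isOpen_ball hw]
      ext; simp [(hder w hw).hasFDerivAt.fderiv]) hz hc
  simp only [hL.1, Complex.exp_neg, Complex.exp_log (h0 c hc)] at hconst
  rw [mul_inv_cancel₀ (h0 c hc)] at hconst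
  field_simp at hconst
  exact hconst.symm

/-- Since 1 - F² has no zeros it has a square root G, and (F + iG)(F - iG) = 1 gives F + iG = exp P,
so F = cos(-iP). Periodicity and evenness of cosine then adjust the branch to the value `b` at the
centre. -/
theorem exists_cos_pi_eq_on_ball {F : ℂ → ℂ} {c b : ℂ} {ρ : ℝ}
    (hF : DifferentiableOn ℂ F (ball c ρ)) (h1 : ∀ z ∈ ball c ρ, F z ≠ 1 ∧ F z ≠ -1)
    (hρ : 0 < ρ) (hb : Complex.cos (Real.pi * b) = F c) :
    ∃ φ : ℂ → ℂ, DifferentiableOn ℂ φ (ball c ρ) ∧ φ c = b ∧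
      ∀ z ∈ ball c ρ, Complex.cos (Real.pi * φ z) = F z := by
  obtain ⟨L, hLd, hL⟩ := exists_exp_eq_on_ball (g := fun z => 1 - F z ^ 2) (c := c) (ρ := ρ)
    (by fun_prop) (fun z hz h => by
      have : (F z - 1) * (F z + 1) = 0 := by linear_combination -h
      rcases mul_eq_zero.mp this with h | h
      · exact (h1 z hz).1 (sub_eq_zero.mp h)
      · exact (h1 z hz).2 (eq_neg_of_add_eq_zero_left h))
  set G : ℂ → ℂ := fun z => Complex.exp (L z / 2) with hG
  have hGd : DifferentiableOn ℂ G (ball c ρ) := by fun_prop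
  have hG2 : ∀ z ∈ ball c ρ, G z ^ 2 = 1 - F z ^ 2 := fun z hz => by
    rw [← hL z hz, hG]; simp only [← Complex.exp_nat_mul]; congr 1; push_cast; ring
  have hprod : ∀ z ∈ ball c ρ, (F z + Complex.I * G z) * (F z - Complex.I * G z) = 1 :=
    fun z hz => by
      linear_combination hG2 z hz - G z ^ 2 * Complex.I_sq
  obtain ⟨P, hPd, hP⟩ := exists_exp_eq_on_ball (g := fun z => F z + Complex.I * G z)
    (c := c) (ρ := ρ) (by fun_prop) (fun z hz => left_ne_zero_of_mul_eq_one (hprod z hz))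
  have hcos : ∀ z ∈ ball c ρ, Complex.cos (-Complex.I * P z) = F z := fun z hz => by
    have e1 : -Complex.I * P z * Complex.I = P z := by linear_combination -P z * Complex.I_sq
    have e2 : -(-Complex.I * P z) * Complex.I = -P z := by linear_combination P z * Complex.I_sq
    rw [Complex.cos, e1, e2, Complex.exp_neg, hP z hz,
      ← eq_inv_of_mul_eq_one_right (hprod z hz)]
    ring
  have hc : c ∈ ball c ρ := mem_ball_self hρ
  have hpi : (Real.pi : ℂ) ≠ 0 := by exact_mod_cast Real.pi_ne_zero
  obtain ⟨k, hk⟩ := Complex.cos_eq_cos_iff.mp ((hcos c hc).trans hb.symm)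
  rcases hk with hk | hk
  · refine ⟨fun z => (2 * k * Real.pi + -Complex.I * P z) / Real.pi, by fun_prop, ?_, ?_⟩
    · simp only; rw [← hk]; field_simp
    · intro z hz
      rw [← hcos z hz, mul_div_cancel₀ _ hpi]
      exact (Complex.cos_eq_cos_iff.mpr ⟨k, Or.inl rfl⟩).symm
  · refine ⟨fun z => (2 * k * Real.pi - -Complex.I * P z) / Real.pi, by fun_prop, ?_, ?_⟩
    · simp only; rw [← hk]; field_simp
    · intro z hz
      rw [← hcos z hz, mul_div_cancel₀ _ hpi]
      exact (Complex.cos_eq_cos_iff.mpr ⟨k, Or.inr rfl⟩).symm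

theorem abs_sinh_im_le_norm_cos (z : ℂ) : |Real.sinh z.im| ≤ ‖Complex.cos z‖ := by
  have h := abs_norm_sub_norm_le (Complex.exp (z * Complex.I)) (-Complex.exp (-z * Complex.I))
  rw [norm_neg, Complex.norm_exp, Complex.norm_exp, sub_neg_eq_add] at h
  have e : ‖Complex.cos z‖ = ‖Complex.exp (z * Complex.I) + Complex.exp (-z * Complex.I)‖ / 2 := by
    rw [Complex.cos, norm_div]; simp
  simp only [Complex.mul_re, Complex.I_re, Complex.I_im, Complex.neg_re, Complex.neg_im,
    mul_zero, mul_one, zero_sub, neg_neg] at h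
  rw [e, Real.sinh_eq, abs_div, abs_sub_comm]
  simp only [abs_two]
  gcongr

theorem exists_cos_pi_eq (w : ℂ) :
    ∃ b : ℂ, Complex.cos (Real.pi * b) = w ∧ ‖b‖ ≤ 1 + ‖w‖ := by
  obtain ⟨x, hx⟩ := Complex.cos_surjective w
  have hpi : (Real.pi : ℂ) ≠ 0 := by exact_mod_cast Real.pi_ne_zero
  set k : ℤ := round ((x / Real.pi).re / 2)
  set b : ℂ := x / Real.pi - 2 * k with hb
  have hcos : Complex.cos (Real.pi * b) = w := by
    rw [← hx, hb]
    refine Complex.cos_eq_cos_iff.mpr ⟨k, Or.inl ?_⟩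
    field_simp
    ring
  refine ⟨b, hcos, ?_⟩
  have hre : |b.re| ≤ 1 := by
    have := abs_sub_round ((x / Real.pi).re / 2)
    have e : b.re = 2 * ((x / Real.pi).re / 2 - k) := by
      rw [hb, Complex.sub_re]; simp; ring
    rw [e, abs_mul, abs_two]; linarith
  have him : |b.im| ≤ ‖w‖ := by
    have h1 := abs_sinh_im_le_norm_cos (Real.pi * b)
    rw [hcos] at h1
    have h2 : ((Real.pi : ℂ) * b).im = Real.pi * b.im := by simp
    rw [h2, Real.abs_sinh] at h1
    have h3 := Real.self_le_sinh_iff.mpr (abs_nonneg (Real.pi * b.im))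
    rw [abs_mul, abs_of_pos Real.pi_pos] at h3 h1
    nlinarith [Real.pi_gt_three, abs_nonneg b.im]
  exact (Complex.norm_le_abs_re_add_abs_im b).trans (add_le_add hre him)

theorem two_le_cosh_pi_div_two : 2 ≤ Real.cosh (Real.pi / 2) := by
  have h := Real.pi_gt_three
  have h1 : Real.exp (1 + 1 / 2) ≤ Real.exp (Real.pi / 2) := Real.exp_le_exp.mpr (by linarith)
  have h2 := Real.exp_one_gt_d9
  have h3 := Real.quadratic_le_exp_of_nonneg (x := 1 / 2) (by norm_num)
  rw [Real.exp_add] at h1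
  rw [Real.cosh_eq]
  nlinarith [Real.exp_pos (-(Real.pi / 2))]

/-- On vertical lines with integer real part, cos(πp) is ±cosh(π Im p), which grows by at least 1
over a height of 1/2 and so passes an integer. This makes Bloch's theorem applicable to a function
`g` for which cos(πg) omits the integers. -/
theorem exists_mem_ball_cos_pi_eq_int (w : ℂ) :
    ∃ p ∈ ball w 1, ∃ n : ℤ, Complex.cos (Real.pi * p) = n := by
  set t := |w.im|
  have hgap : Real.cosh (Real.pi * t) + 1 ≤ Real.cosh (Real.pi * (t + 1 / 2)) := by
    have e : Real.pi * (t + 1 / 2) = Real.pi * t + Real.pi / 2 := by ring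
    rw [e, Real.cosh_add]
    have h1 : 0 ≤ Real.sinh (Real.pi * t) := Real.sinh_nonneg_iff.mpr (by positivity)
    have h2 : 0 ≤ Real.sinh (Real.pi / 2) := Real.sinh_nonneg_iff.mpr (by positivity)
    nlinarith [Real.one_le_cosh (Real.pi * t), two_le_cosh_pi_div_two, mul_nonneg h1 h2]
  obtain ⟨s, hs, hn⟩ := intermediate_value_Icc (f := fun s => Real.cosh (Real.pi * s))
    (show t ≤ t + 1 / 2 by linarith) (by fun_prop)
    (show ((⌈Real.cosh (Real.pi * t)⌉ : ℤ) : ℝ) ∈ _ from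
      ⟨Int.le_ceil _, (Int.ceil_lt_add_one _).le.trans hgap⟩)
  obtain ⟨y, hy1, hy2⟩ : ∃ y : ℝ, |w.im - y| ≤ 1 / 2 ∧ (y = s ∨ y = -s) := by
    rcases abs_cases w.im with ⟨h, _⟩ | ⟨h, _⟩
    · exact ⟨s, abs_le.mpr ⟨by linarith [hs.2, h], by linarith [hs.1, h]⟩, Or.inl rfl⟩
    · exact ⟨-s, abs_le.mpr ⟨by linarith [hs.1, h], by linarith [hs.2, h]⟩, Or.inr rfl⟩
  have hcy : Real.cosh (Real.pi * y) = (⌈Real.cosh (Real.pi * t)⌉ : ℤ) := by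
    rcases hy2 with rfl | rfl
    · exact hn
    · rw [mul_neg, Real.cosh_neg]; exact hn
  set m : ℤ := round w.re
  refine ⟨m + y * Complex.I, ?_, ?_⟩
  · rw [mem_ball, dist_comm, dist_eq_norm]
    have hre : |w.re - m| ≤ 1 / 2 := abs_sub_round _
    rw [← sq_lt_one_iff₀ (norm_nonneg _), Complex.sq_norm, Complex.normSq_apply]
    have e1 : (w - (m + y * Complex.I)).re = w.re - m := by simp
    have e2 : (w - (m + y * Complex.I)).im = w.im - y := by simp
    rw [e1, e2]
    have := abs_le.mp hre
    have := abs_le.mp hy1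
    nlinarith
  · obtain ⟨n', hn'⟩ : ∃ n' : ℤ, Complex.cos (m * Real.pi) = n' :=
      ⟨Int.negOnePow m, by
        have := Real.cos_int_mul_pi m
        rw [show ((m : ℂ) * (Real.pi : ℂ)) = ((m * Real.pi : ℝ) : ℂ) by push_cast; rfl,
          ← Complex.ofReal_cos, this]
        rcases Int.even_or_odd m with h | h
        · simp [h.neg_one_zpow, Int.negOnePow_even m h]
        · simp [h.neg_one_zpow, Int.negOnePow_odd m h]⟩
    refine ⟨n' * ⌈Real.cosh (Real.pi * t)⌉, ?_⟩
    have e : (Real.pi : ℂ) * (m + y * Complex.I) =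
        (m * Real.pi : ℂ) + ((Real.pi * y : ℝ) : ℂ) * Complex.I := by push_cast; ring
    have hsin : Complex.sin (m * Real.pi) = 0 := Complex.sin_int_mul_pi m
    rw [e, Complex.cos_add, hsin, zero_mul, sub_zero, hn', Complex.cos_mul_I,
      ← Complex.ofReal_cosh, hcy]
    push_cast
    ring

theorem norm_cos_le_exp_norm (z : ℂ) : ‖Complex.cos z‖ ≤ Real.exp ‖z‖ := by
  rw [Complex.cos, norm_div, Complex.norm_ofNat, div_le_iff₀ (by norm_num)]
  refine (norm_add_le _ _).trans ?_
  have h1 := Complex.norm_exp_le_exp_norm (z * Complex.I)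
  have h2 := Complex.norm_exp_le_exp_norm (-z * Complex.I)
  simp only [norm_mul, norm_neg, Complex.norm_I, mul_one] at h1 h2
  linarith

/-- **Schottky's theorem.** -/
theorem schottky (K : ℝ) : ∃ C : ℝ, ∀ (F : ℂ → ℂ) (c : ℂ) (ρ : ℝ), 0 < ρ →
    DifferentiableOn ℂ F (ball c ρ) → (∀ z ∈ ball c ρ, F z ≠ 0 ∧ F z ≠ 1) → ‖F c‖ ≤ K →
    ∀ z ∈ ball c (ρ / 2), ‖F z‖ ≤ C := by
  -- Two successive arccosines of 2F - 1 have central values bounded by 2 + 2K and 3 + 2K; Bloch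
  -- adds 96, and the two exponentials undo the cosines.
  refine ⟨1 + Real.exp (Real.pi * Real.exp (Real.pi * (99 + 2 * K))), ?_⟩
  intro F c ρ hρ hF h01 hK z hz
  have hpi := Real.pi_pos
  have hc : c ∈ ball c ρ := mem_ball_self hρ
  obtain ⟨b, hb, hbn⟩ := exists_cos_pi_eq (2 * F c - 1)
  obtain ⟨φ, hφd, hφc, hφ⟩ := exists_cos_pi_eq_on_ball (F := fun z => 2 * F z - 1) (c := c)
    (ρ := ρ) (by fun_prop) (fun z hz => ⟨fun h => (h01 z hz).2 (by linear_combination h / 2),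
      fun h => (h01 z hz).1 (by linear_combination h / 2)⟩) hρ hb
  have hint : ∀ z ∈ ball c ρ, ∀ n : ℤ, φ z ≠ n := by
    intro z hz n hn
    have h1 := hφ z hz
    rw [hn] at h1
    have hsin : Complex.sin (Real.pi * n) = 0 := by rw [mul_comm]; exact Complex.sin_int_mul_pi n
    have h2 := Complex.sin_sq_add_cos_sq (Real.pi * n)
    rw [hsin, h1] at h2
    have h3 : F z * (F z - 1) = 0 := by linear_combination h2 / 4
    rcases mul_eq_zero.mp h3 with h | h
    · exact (h01 z hz).1 h
    · exact (h01 z hz).2 (sub_eq_zero.mp h)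
  obtain ⟨b', hb', hbn'⟩ := exists_cos_pi_eq (φ c)
  obtain ⟨g, hgd, hgc, hg⟩ := exists_cos_pi_eq_on_ball (F := φ) hφd
    (fun z hz => ⟨by simpa using hint z hz 1, by simpa using hint z hz (-1)⟩) hρ hb'
  have hno : ∀ w, ¬ ball w 1 ⊆ g '' ball c ρ := by
    intro w hw
    obtain ⟨p, hp, n, hn⟩ := exists_mem_ball_cos_pi_eq_int w
    obtain ⟨z, hz, rfl⟩ := hw hp
    exact hint z hz n (by rw [← hg z hz, hn])
  have hz' : z ∈ ball c ρ := ball_subset_ball (by linarith) hz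
  have h1 := norm_sub_le_of_no_unit_ball hρ hgd hno hz
  have hgz : ‖g z‖ ≤ 99 + 2 * K := by
    have a1 : ‖2 * F c - 1‖ ≤ 2 * K + 1 := by
      refine (norm_sub_le _ _).trans ?_
      simp only [norm_mul, Complex.norm_ofNat, norm_one]; linarith
    have a2 := norm_add_le (g z - g c) (g c)
    rw [sub_add_cancel] at a2
    rw [hgc] at a2 h1
    rw [hφc] at hbn'
    linarith
  have hφz : ‖φ z‖ ≤ Real.exp (Real.pi * (99 + 2 * K)) := by
    rw [← hg z hz']
    refine (norm_cos_le_exp_norm _).trans (Real.exp_le_exp.mpr ?_)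
    rw [norm_mul, Complex.norm_real, Real.norm_of_nonneg hpi.le]
    gcongr
  have hFz : ‖2 * F z - 1‖ ≤ Real.exp (Real.pi * Real.exp (Real.pi * (99 + 2 * K))) := by
    rw [← hφ z hz']
    refine (norm_cos_le_exp_norm _).trans (Real.exp_le_exp.mpr ?_)
    rw [norm_mul, Complex.norm_real, Real.norm_of_nonneg hpi.le]
    gcongr
  have h2 := norm_add_le (2 * F z - 1) 1
  rw [sub_add_cancel, norm_mul, norm_one, Complex.norm_ofNat] at h2
  linarith [norm_nonneg (F z)]

/-- The constant depends on `K` alone, which allows omitted values that vary with the disc. -/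
theorem schottky_of_omits (K : ℝ) : ∃ C : ℝ, ∀ (F : ℂ → ℂ) (a b c : ℂ) (ρ : ℝ), 0 < ρ → a ≠ b →
    DifferentiableOn ℂ F (ball c ρ) → (∀ z ∈ ball c ρ, F z ≠ a ∧ F z ≠ b) →
    ‖F c - a‖ ≤ K * ‖b - a‖ → ∀ z ∈ ball c (ρ / 2), ‖F z - a‖ ≤ C * ‖b - a‖ := by
  obtain ⟨C, hC⟩ := schottky K
  refine ⟨C, fun F a b c ρ hρ hab hF hom hK z hz => ?_⟩
  have hba : b - a ≠ 0 := sub_ne_zero.mpr hab.symm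
  have hpos : 0 < ‖b - a‖ := norm_pos_iff.mpr hba
  have := hC (fun z => (F z - a) / (b - a)) c ρ hρ (by fun_prop) (fun w hw => ⟨?_, ?_⟩)
    (by rw [norm_div, div_le_iff₀ hpos]; exact hK) z hz
  · rwa [norm_div, div_le_iff₀ hpos] at this
  · exact div_ne_zero (sub_ne_zero.mpr (hom w hw).1) hba
  · intro h
    rw [div_eq_one_iff_eq hba] at h
    exact (hom w hw).2 (sub_left_injective h)

/-! ### Growth of the maximum modulus -/

section MaxModulus

variable {f : ℂ → ℂ}

theorem exists_norm_eq_maxModulus (hf : Continuous f) {r : ℝ} (hr : 0 ≤ r) :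
    ∃ z, ‖z‖ = r ∧ ‖f z‖ = maxModulus f r := by
  have hne : ((fun z => ‖f z‖) '' sphere (0 : ℂ) r).Nonempty :=
    (NormedSpace.sphere_nonempty.mpr hr).image _
  obtain ⟨z, hz, h⟩ := (((isCompact_sphere (0 : ℂ) r).image hf.norm).sSup_mem hne)
  exact ⟨z, by simpa using hz, h⟩

theorem norm_le_maxModulus (hf : Continuous f) (z : ℂ) : ‖f z‖ ≤ maxModulus f ‖z‖ :=
  le_csSup ((isCompact_sphere (0 : ℂ) ‖z‖).image hf.norm).bddAbove ⟨z, by simp, rfl⟩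

theorem norm_le_maxModulus_of_norm_le (hf : Differentiable ℂ f) {z : ℂ} {r : ℝ} (h : ‖z‖ ≤ r) :
    ‖f z‖ ≤ maxModulus f r := by
  rcases h.eq_or_lt with rfl | h
  · exact norm_le_maxModulus hf.continuous z
  have hr : r ≠ 0 := ((norm_nonneg z).trans_lt h).ne'
  refine Complex.norm_le_of_forall_mem_frontier_norm_le (isBounded_ball (x := (0 : ℂ)) (r := r))
    hf.diffContOnCl (fun w hw => ?_) (subset_closure (by simpa using h))
  rw [frontier_ball _ hr, mem_sphere_zero_iff_norm] at hw
  exact hw ▸ norm_le_maxModulus hf.continuous w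

theorem maxModulus_mono (hf : Differentiable ℂ f) {r s : ℝ} (hr : 0 ≤ r) (h : r ≤ s) :
    maxModulus f r ≤ maxModulus f s := by
  obtain ⟨z, hz, e⟩ := exists_norm_eq_maxModulus hf.continuous hr
  exact e ▸ norm_le_maxModulus_of_norm_le hf (hz.trans_le h)

theorem eq_add_mul_dslope (f : ℂ → ℂ) (z : ℂ) : f z = f 0 + z * dslope f 0 z := by
  have := sub_smul_dslope f 0 z
  rw [sub_zero, smul_eq_mul] at this
  rw [this]; ring

theorem IsTranscendentalEntire.dslope (hf : IsTranscendentalEntire f) :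
    IsTranscendentalEntire (dslope f 0) := by
  refine ⟨?_, ?_⟩
  · rw [← differentiableOn_univ, Complex.differentiableOn_dslope univ_mem]
    exact hf.1.differentiableOn
  · rintro ⟨p, hp⟩
    refine hf.2 ⟨Polynomial.C (f 0) + Polynomial.X * p, fun z => ?_⟩
    rw [eq_add_mul_dslope f z, hp]
    simp

theorem mul_maxModulus_dslope_le (hf : Differentiable ℂ f) (hg : Continuous (_root_.dslope f 0))
    {r : ℝ} (hr : 0 ≤ r) :
    r * maxModulus (_root_.dslope f 0) r ≤ maxModulus f r + ‖f 0‖ := by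
  obtain ⟨z, hz, e⟩ := exists_norm_eq_maxModulus hg hr
  have h : z * _root_.dslope f 0 z = f z - f 0 := by rw [eq_add_mul_dslope f z]; ring
  rw [← e]
  nth_rw 1 [← hz]
  rw [← norm_mul, h]
  exact (norm_sub_le _ _).trans (by
    gcongr; exact norm_le_maxModulus_of_norm_le hf hz.le)

theorem maxModulus_le_mul_maxModulus_dslope (hf : Differentiable ℂ f)
    (hg : Continuous (_root_.dslope f 0)) {r : ℝ} (hr : 0 ≤ r) :
    maxModulus f r ≤ r * maxModulus (_root_.dslope f 0) r + ‖f 0‖ := by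
  obtain ⟨z, hz, e⟩ := exists_norm_eq_maxModulus hf.continuous hr
  rw [← e, eq_add_mul_dslope f z, add_comm]
  refine (norm_add_le _ _).trans ?_
  rw [norm_mul, ← hz]
  gcongr
  exact norm_le_maxModulus hg z

theorem IsTranscendentalEntire.eventually_le_maxModulus (hf : IsTranscendentalEntire f) (C : ℝ) :
    ∀ᶠ r in atTop, C ≤ maxModulus f r := by
  obtain ⟨z, hz⟩ : ∃ z, C < ‖f z‖ := by
    by_contra! h
    obtain ⟨c, hc⟩ := hf.1.exists_const_forall_eq_of_bounded
      (isBounded_iff_forall_norm_le.mpr ⟨C, by rintro _ ⟨z, rfl⟩; exact h z⟩)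
    exact hf.2 ⟨Polynomial.C c, by simpa using hc⟩
  filter_upwards [eventually_ge_atTop ‖z‖] with r hr
  exact hz.le.trans (norm_le_maxModulus_of_norm_le hf.1 hr)

/-- Passing to the quotient (f(z) - f(0))/z, again transcendental entire, gains one power of r;
Liouville's theorem starts the induction. -/
theorem IsTranscendentalEntire.eventually_mul_pow_le_maxModulus (hf : IsTranscendentalEntire f)
    (C : ℝ) (N : ℕ) : ∀ᶠ r in atTop, C * r ^ N ≤ maxModulus f r := by
  induction N generalizing f C with
  | zero => simpa using hf.eventually_le_maxModulus C
  | succ N ih =>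
    filter_upwards [ih hf.dslope (C + 1), eventually_ge_atTop 1, eventually_ge_atTop ‖f 0‖]
      with r h1 h2 h3
    have h4 := mul_maxModulus_dslope_le hf.1 hf.dslope.1.continuous (zero_le_one.trans h2)
    have h5 : r * ((C + 1) * r ^ N) ≤ r * maxModulus (_root_.dslope f 0) r := by gcongr
    have h6 : r ≤ r ^ (N + 1) := le_self_pow₀ h2 (by simp)
    have h7 : r * ((C + 1) * r ^ N) = C * r ^ (N + 1) + r ^ (N + 1) := by ring
    linarith

/-- Each passage to (f(z) - f(0))/z gains a factor κ, up to an error from f(0). The slack between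
`q` and κ absorbs it once M(r) is large. -/
theorem IsTranscendentalEntire.eventually_pow_mul_maxModulus_le (hf : IsTranscendentalEntire f)
    {κ q : ℝ} (hq : 0 ≤ q) (hqκ : q < κ) (N : ℕ) (hκ : 1 ≤ κ) :
    ∀ᶠ r in atTop, q ^ N * maxModulus f r ≤ maxModulus f (κ * r) := by
  induction N generalizing f with
  | zero =>
    filter_upwards [eventually_ge_atTop 0] with r hr
    rw [pow_zero, one_mul]
    exact maxModulus_mono hf.1 hr (le_mul_of_one_le_left hr hκ)
  | succ N ih =>
    have hpos : 0 < κ - q := sub_pos.mpr hqκ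
    rcases hq.eq_or_lt with rfl | hq0
    · filter_upwards [eventually_ge_atTop 0] with r hr
      obtain ⟨z, -, e⟩ := exists_norm_eq_maxModulus hf.1.continuous
        (mul_nonneg (zero_le_one.trans hκ) hr)
      simp [← e]
    filter_upwards [ih hf.dslope, eventually_ge_atTop 0,
      hf.eventually_le_maxModulus ((κ * q ^ N + 1) * ‖f 0‖ / ((κ - q) * q ^ N))] with r h1 h2 h3
    have hκr : 0 ≤ κ * r := mul_nonneg (zero_le_one.trans hκ) h2
    have h4 := mul_maxModulus_dslope_le hf.1 hf.dslope.1.continuous hκr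
    have h5 := maxModulus_le_mul_maxModulus_dslope hf.1 hf.dslope.1.continuous h2
    rw [div_le_iff₀ (by positivity)] at h3
    have h6 : κ * r * (q ^ N * maxModulus (_root_.dslope f 0) r) ≤
      κ * r * maxModulus (_root_.dslope f 0) (κ * r) := by gcongr
    have h7 : κ * q ^ N * maxModulus f r ≤
        κ * q ^ N * (r * maxModulus (_root_.dslope f 0) r + ‖f 0‖) := by gcongr
    rw [pow_succ]
    nlinarith

theorem IsTranscendentalEntire.eventually_mul_maxModulus_le (hf : IsTranscendentalEntire f)
    {κ : ℝ} (hκ : 1 < κ) (C : ℝ) :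
    ∀ᶠ r in atTop, C * maxModulus f r ≤ maxModulus f (κ * r) := by
  obtain ⟨q, hq1, hq2⟩ := exists_between hκ
  obtain ⟨N, hN⟩ := pow_unbounded_of_one_lt C hq1
  filter_upwards [hf.eventually_pow_mul_maxModulus_le (zero_le_one.trans hq1.le) hq2 N hκ.le,
    hf.eventually_le_maxModulus 0] with r h1 h2
  exact (mul_le_mul_of_nonneg_right hN.le h2).trans h1

theorem IsTranscendentalEntire.exists_isAdmissibleRadius (hf : IsTranscendentalEntire f) :
    ∃ R, IsAdmissibleRadius f R := by
  obtain ⟨R, hR⟩ := eventually_atTop.mp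
    ((hf.eventually_mul_pow_le_maxModulus 2 1).and (eventually_gt_atTop 0))
  refine ⟨R, (hR R le_rfl).2, fun r hr => ?_⟩
  have := hR r hr
  rw [pow_one] at this
  linarith [this.1, this.2]

theorem IsAdmissibleRadius.le_iterate {R : ℝ} (hR : IsAdmissibleRadius f R) (n : ℕ) :
    R ≤ (maxModulus f)^[n] R := by
  induction n with
  | zero => exact le_rfl
  | succ n ih =>
    rw [Function.iterate_succ_apply']
    exact ih.trans (hR.2 _ ih).le

theorem IsAdmissibleRadius.strictMono_iterate {R : ℝ} (hR : IsAdmissibleRadius f R) :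
    StrictMono fun n => (maxModulus f)^[n] R :=
  strictMono_nat_of_lt_succ fun n => by
    rw [Function.iterate_succ_apply']
    exact hR.2 _ (hR.le_iterate n)

theorem IsAdmissibleRadius.tendsto_iterate {R : ℝ} (hf : Continuous f)
    (hR : IsAdmissibleRadius f R) :
    Tendsto (fun n => (maxModulus f)^[n] R) atTop atTop := by
  rcases tendsto_atTop_of_monotone hR.strictMono_iterate.monotone with h | ⟨l, hl⟩
  · exact h
  exfalso
  have hle : ∀ n, (maxModulus f)^[n] R ≤ l := hR.strictMono_iterate.monotone.ge_of_tendsto hl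
  have hRl : R ≤ l := hle 0
  have hl0 : 0 < l := hR.1.trans_le hRl
  obtain ⟨z, hz, e⟩ := exists_norm_eq_maxModulus hf hl0.le
  -- A maximum point on the limiting circle is scaled radially, which replaces continuity of M and
  -- yields M(l) ≤ l.
  have hlim : Tendsto (fun n => ‖f ((((maxModulus f)^[n] R / l : ℝ) : ℂ) * z)‖) atTop
      (𝓝 ‖f z‖) := by
    have h1 : Tendsto (fun n => (((maxModulus f)^[n] R / l : ℝ) : ℂ) * z) atTop (𝓝 z) := by
      have := ((Complex.continuous_ofReal.tendsto _).comp (hl.div_const l)).mul_const z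
      rwa [div_self hl0.ne', Complex.ofReal_one, one_mul] at this
    exact (hf.norm.tendsto z).comp h1
  have : ‖f z‖ ≤ l := le_of_tendsto' hlim fun n => by
    refine (norm_le_maxModulus hf _).trans ?_
    have hn : ‖(((maxModulus f)^[n] R / l : ℝ) : ℂ) * z‖ = (maxModulus f)^[n] R := by
      rw [norm_mul, hz, Complex.norm_real, Real.norm_of_nonneg
        (div_nonneg (hR.1.le.trans (hR.le_iterate n)) hl0.le), div_mul_cancel₀ _ hl0.ne']
    rw [hn, ← Function.iterate_succ_apply' (maxModulus f)]
    exact hle _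
  linarith [hR.2 l hRl]

theorem iterate_maxModulus_le (hf : Differentiable ℂ f) {R : ℝ} (hR : IsAdmissibleRadius f R)
    {S : ℕ → ℝ} (h0 : R ≤ S 0) (hS : ∀ n, maxModulus f (S n) ≤ S (n + 1)) (n : ℕ) :
    (maxModulus f)^[n] R ≤ S n := by
  induction n with
  | zero => exact h0
  | succ n ih =>
    rw [Function.iterate_succ_apply']
    exact (maxModulus_mono hf (hR.1.le.trans (hR.le_iterate n)) ih).trans (hS n)

end MaxModulus

/-! ### Fatou and Julia sets, invariance, Montel's theorem -/

/-- Sequential precompactness of the iterates of `f` for uniform convergence on `s`, the limit `∞`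
being allowed. -/
def IteratesNormalUniformlyOn (f : ℂ → ℂ) (s : Set ℂ) : Prop :=
  ∀ n : ℕ → ℕ, ∃ φ : ℕ → ℕ, StrictMono φ ∧
    ((∃ h : ℂ → ℂ, TendstoUniformlyOn (fun k => f^[n (φ k)]) h atTop s) ∨
      ∀ C : ℝ, ∀ᶠ k in atTop, ∀ z ∈ s, C ≤ ‖f^[n (φ k)] z‖)

section Fatou

variable {f : ℂ → ℂ}

theorem IteratesNormalUniformlyOn.mono {s t : Set ℂ} (h : IteratesNormalUniformlyOn f t)
    (hst : s ⊆ t) : IteratesNormalUniformlyOn f s := fun n => by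
  obtain ⟨φ, hφ, ⟨g, hg⟩ | hg⟩ := h n
  · exact ⟨φ, hφ, Or.inl ⟨g, hg.mono hst⟩⟩
  · exact ⟨φ, hφ, Or.inr fun C => (hg C).mono fun k hk z hz => hk z (hst hz)⟩

theorem exists_closedBall_of_mem_fatouSet {z : ℂ} (hz : z ∈ fatouSet f) :
    ∃ ρ > 0, IteratesNormalUniformlyOn f (closedBall z ρ) := by
  obtain ⟨U, hU, -, hzU, hn⟩ := hz
  obtain ⟨ρ, hρ, hsub⟩ := nhds_basis_closedBall.mem_iff.mp (hU.mem_nhds hzU)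
  refine ⟨ρ, hρ, fun n => ?_⟩
  obtain ⟨φ, hφ, ⟨h, hh⟩ | hh⟩ := hn (fun k => f^[n k]) fun k => ⟨n k, rfl⟩
  · exact ⟨φ, hφ, Or.inl ⟨h, (tendstoLocallyUniformlyOn_iff_forall_isCompact hU).mp hh _ hsub
      (isCompact_closedBall z ρ)⟩⟩
  · exact ⟨φ, hφ, Or.inr fun C => hh _ hsub (isCompact_closedBall z ρ) C⟩

theorem mem_fatouSet_of_ball {z : ℂ} {ρ : ℝ} (hρ : 0 < ρ)
    (h : IteratesNormalUniformlyOn f (ball z ρ)) : z ∈ fatouSet f := by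
  refine ⟨ball z ρ, isOpen_ball, (convex_ball z ρ).isConnected ⟨z, mem_ball_self hρ⟩,
    mem_ball_self hρ, fun g hg => ?_⟩
  choose n hn using hg
  obtain rfl : (fun k => f^[n k]) = g := funext hn
  obtain ⟨φ, hφ, ⟨h, hh⟩ | hh⟩ := h n
  · exact ⟨φ, hφ, Or.inl ⟨h, hh.tendstoLocallyUniformlyOn⟩⟩
  · exact ⟨φ, hφ, Or.inr fun K hK _ C => (hh C).mono fun k hk w hw => hk w (hK hw)⟩

theorem isOpen_fatouSet (f : ℂ → ℂ) : IsOpen (fatouSet f) :=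
  isOpen_iff_mem_nhds.mpr fun _ ⟨U, hU, hc, hzU, hn⟩ =>
    mem_of_superset (hU.mem_nhds hzU) fun _ hw => ⟨U, hU, hc, hw, hn⟩

theorem isClosed_juliaSet (f : ℂ → ℂ) : IsClosed (juliaSet f) := (isOpen_fatouSet f).isClosed_compl

theorem mem_fatouSet_of_apply_mem (hf : Continuous f) {z : ℂ} (hz : f z ∈ fatouSet f) :
    z ∈ fatouSet f := by
  obtain ⟨ρ, hρ, hN⟩ := exists_closedBall_of_mem_fatouSet hz
  obtain ⟨δ, hδ, hsub⟩ := Metric.mem_nhds_iff.mp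
    (hf.continuousAt.preimage_mem_nhds (closedBall_mem_nhds (f z) hρ))
  refine mem_fatouSet_of_ball hδ fun n => ?_
  -- The zeroth iterate does not factor through `f`; if it recurs, the identity is a subsequential
  -- limit.
  by_cases h0 : ∃ᶠ k in atTop, n k = 0
  · obtain ⟨φ, hφ, h⟩ := extraction_of_frequently_atTop h0
    refine ⟨φ, hφ, Or.inl ⟨id, Metric.tendstoUniformlyOn_iff.mpr fun ε hε =>
      Eventually.of_forall fun k w _ => ?_⟩⟩
    simp [h k, hε]
  · rw [not_frequently] at h0
    obtain ⟨φ, hφ, h⟩ := hN fun k => n k - 1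
    have hev : ∀ᶠ k in atTop, ∀ w, f^[n (φ k)] w = f^[n (φ k) - 1] (f w) := by
      filter_upwards [hφ.tendsto_atTop.eventually h0] with k hk w
      rw [← Function.iterate_succ_apply, Nat.succ_eq_add_one, Nat.sub_add_cancel
        (Nat.one_le_iff_ne_zero.mpr hk)]
    refine ⟨φ, hφ, ?_⟩
    rcases h with ⟨h, hh⟩ | hh
    · refine Or.inl ⟨h ∘ f, Metric.tendstoUniformlyOn_iff.mpr fun ε hε => ?_⟩
      filter_upwards [Metric.tendstoUniformlyOn_iff.mp hh ε hε, hev] with k h1 h2 w hw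
      rw [h2]
      exact h1 _ (hsub hw)
    · refine Or.inr fun C => ?_
      filter_upwards [hh C, hev] with k h1 h2 w hw
      rw [h2]
      exact h1 _ (hsub hw)

theorem IsTranscendentalEntire.isOpenMap (hf : IsTranscendentalEntire f) : IsOpenMap f := by
  refine (hf.1.differentiableOn.analyticOnNhd isOpen_univ).is_constant_or_isOpenMap.resolve_left ?_
  rintro ⟨w, hw⟩
  exact hf.2 ⟨Polynomial.C w, by simpa using hw⟩

theorem apply_mem_fatouSet (hf : IsTranscendentalEntire f) {z : ℂ} (hz : z ∈ fatouSet f) :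
    f z ∈ fatouSet f := by
  obtain ⟨ρ, hρ, hN⟩ := exists_closedBall_of_mem_fatouSet hz
  obtain ⟨δ, hδ, hsub⟩ := Metric.mem_nhds_iff.mp
    (hf.isOpenMap.image_mem_nhds (closedBall_mem_nhds z hρ))
  refine mem_fatouSet_of_ball hδ fun n => ?_
  -- A set-theoretic section of `f` suffices: uniform convergence survives composition with any map.
  have hsec : ∀ w, ∃ v, w ∈ ball (f z) δ → v ∈ closedBall z ρ ∧ f v = w := fun w => by
    by_cases hw : w ∈ ball (f z) δ
    · obtain ⟨v, h1, h2⟩ := hsub hw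
      exact ⟨v, fun _ => ⟨h1, h2⟩⟩
    · exact ⟨0, fun h => absurd h hw⟩
  choose s hs using hsec
  have hit : ∀ w ∈ ball (f z) δ, ∀ m, f^[m] w = f^[m + 1] (s w) := fun w hw m => by
    rw [Function.iterate_succ_apply, (hs w hw).2]
  obtain ⟨φ, hφ, ⟨h, hh⟩ | hh⟩ := hN fun k => n k + 1
  · refine ⟨φ, hφ, Or.inl ⟨h ∘ s, Metric.tendstoUniformlyOn_iff.mpr fun ε hε => ?_⟩⟩
    filter_upwards [Metric.tendstoUniformlyOn_iff.mp hh ε hε] with k hk w hw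
    rw [hit w hw]
    exact hk _ (hs w hw).1
  · refine ⟨φ, hφ, Or.inr fun C => ?_⟩
    filter_upwards [hh C] with k hk w hw
    rw [hit w hw]
    exact hk _ (hs w hw).1

theorem iterate_mem_fatouSet_iff (hf : IsTranscendentalEntire f) (n : ℕ) {z : ℂ} :
    f^[n] z ∈ fatouSet f ↔ z ∈ fatouSet f := by
  induction n generalizing z with
  | zero => rfl
  | succ n ih =>
    rw [Function.iterate_succ_apply, ih]
    exact ⟨mem_fatouSet_of_apply_mem hf.1.continuous, apply_mem_fatouSet hf⟩

theorem iterate_mem_juliaSet_iff (hf : IsTranscendentalEntire f) (n : ℕ) {z : ℂ} :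
    f^[n] z ∈ juliaSet f ↔ z ∈ juliaSet f :=
  not_congr (iterate_mem_fatouSet_iff hf n)

/-- **Montel's theorem** for uniformly bounded sequences on a disc. -/
theorem exists_subseq_tendstoUniformlyOn {g : ℕ → ℂ → ℂ} {c : ℂ} {ρ B : ℝ} (hρ : 0 < ρ)
    (hd : ∀ k, DifferentiableOn ℂ (g k) (ball c ρ)) (hB : ∀ k, ∀ z ∈ ball c ρ, ‖g k z‖ ≤ B) :
    ∃ φ : ℕ → ℕ, StrictMono φ ∧
      ∃ h, TendstoUniformlyOn (fun k => g (φ k)) h atTop (closedBall c (ρ / 2)) := by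
  classical
  set s := closedBall c (ρ / 2) with hs
  have hsub : s ⊆ ball c ρ := closedBall_subset_ball (by linarith)
  -- Cauchy estimates on circles of radius ρ/4 give equicontinuity for Arzelà–Ascoli.
  have hlip : ∀ k, ∀ x ∈ s, ∀ y ∈ s, dist (g k x) (g k y) ≤ B / (ρ / 4) * dist x y := by
    intro k x hx y hy
    rw [dist_eq_norm, dist_eq_norm]
    refine (convex_closedBall c (ρ / 2)).norm_image_sub_le_of_norm_deriv_le
      (fun w hw => (hd k).differentiableAt (isOpen_ball.mem_nhds (hsub hw))) (fun w hw => ?_) hy hx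
    have hw' : closedBall w (ρ / 4) ⊆ ball c ρ := fun v hv => by
      rw [mem_closedBall] at hv hw
      rw [mem_ball]
      linarith [dist_triangle v w c]
    exact Complex.norm_deriv_le_of_forall_mem_sphere_norm_le (by linarith)
      ((hd k).diffContOnCl_ball hw') fun v hv => hB k v (hw' (sphere_subset_closedBall hv))
  have hcs : CompactSpace s := isCompact_iff_compactSpace.mp (isCompact_closedBall c (ρ / 2))
  let G : ℕ → BoundedContinuousFunction s ℂ := fun k => BoundedContinuousFunction.mkOfCompact
    ⟨s.domRestrict (g k), ((hd k).continuousOn.mono hsub).domRestrict⟩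
  have hG : ∀ k (x : s), G k x = g k x := fun k x => rfl
  have hcomp : IsCompact (closure (range G)) := by
    refine BoundedContinuousFunction.arzela_ascoli (closedBall 0 B) (isCompact_closedBall 0 B) _
      ?_ ?_
    · rintro _ x ⟨k, rfl⟩
      rw [mem_closedBall_zero_iff, hG]
      exact hB k x (hsub x.2)
    · refine Metric.equicontinuous_of_continuity_modulus (fun t => B / (ρ / 4) * t) ?_ _ ?_
      · have : Continuous fun t : ℝ => B / (ρ / 4) * t := by fun_prop
        simpa using this.tendsto 0
      · rintro x y ⟨_, k, rfl⟩
        exact hlip k x x.2 y y.2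
  obtain ⟨H, -, φ, hφ, hlim⟩ := hcomp.tendsto_subseq fun k => subset_closure ⟨k, rfl⟩
  rw [BoundedContinuousFunction.tendsto_iff_tendstoUniformly] at hlim
  refine ⟨φ, hφ, fun z => if hz : z ∈ s then H ⟨z, hz⟩ else 0, ?_⟩
  rw [Metric.tendstoUniformlyOn_iff]
  intro ε hε
  filter_upwards [Metric.tendstoUniformly_iff.mp hlim ε hε] with k hk z hz
  simp only [dif_pos hz]
  exact hk ⟨z, hz⟩

/-- **Montel's theorem** for iterates omitting two values from some time on. -/
theorem mem_fatouSet_of_omits (hf : Differentiable ℂ f) {z₀ a b : ℂ} {ρ : ℝ} (hρ : 0 < ρ)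
    (hab : a ≠ b) {N : ℕ} (hom : ∀ n ≥ N, ∀ z ∈ ball z₀ ρ, f^[n] z ≠ a ∧ f^[n] z ≠ b) :
    z₀ ∈ fatouSet f := by
  have hpos : 0 < ‖b - a‖ := norm_pos_iff.mpr (sub_ne_zero.mpr hab.symm)
  have hdn : ∀ n, Differentiable ℂ f^[n] := fun n => hf.iterate n
  have hfin : ∃ B, ∀ n < N, ∀ w ∈ closedBall z₀ ρ, ‖f^[n] w‖ ≤ B := by
    have : ∀ n, ∃ B, ∀ w ∈ closedBall z₀ ρ, ‖f^[n] w‖ ≤ B := fun n =>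
      (isCompact_closedBall z₀ ρ).exists_bound_of_continuousOn (hdn n).continuous.continuousOn
    choose B hB using this
    obtain ⟨M, hM⟩ := (Finset.image B (Finset.range N)).exists_le
    exact ⟨M, fun n hn w hw => (hB n w hw).trans
      (hM _ (Finset.mem_image_of_mem _ (Finset.mem_range.mpr hn)))⟩
  -- Schottky is centred at an arbitrary `z`, so a bound at any one point spreads to all others.
  -- Hence if the values at `z₀` tend to infinity, they do so uniformly nearby.
  have hbound : ∀ K, ∃ B, ∀ n, ∀ z ∈ ball z₀ (ρ / 8), ∀ w ∈ ball z₀ (ρ / 8),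
      ‖f^[n] z‖ ≤ K → ‖f^[n] w‖ ≤ B := by
    intro K
    obtain ⟨B, hB⟩ := hfin
    obtain ⟨C, hC⟩ := schottky_of_omits ((K + ‖a‖) / ‖b - a‖)
    refine ⟨max B (C * ‖b - a‖ + ‖a‖), fun n z hz w hw hK => ?_⟩
    rcases lt_or_ge n N with hn | hn
    · exact (hB n hn w (closedBall_subset_closedBall (by linarith)
        (ball_subset_closedBall hw))).trans (le_max_left _ _)
    · refine le_trans ?_ (le_max_right _ _)
      rw [mem_ball] at hz hw
      have hsub : ball z (ρ / 2) ⊆ ball z₀ ρ := ball_subset (by linarith)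
      have := hC f^[n] a b z (ρ / 2) (by linarith) hab (hdn n).differentiableOn
        (fun v hv => hom n hn v (hsub hv))
        (by rw [div_mul_cancel₀ _ hpos.ne']; exact (norm_sub_le _ _).trans (by gcongr)) w
        (by rw [mem_ball]; linarith [dist_triangle_right w z z₀])
      have h2 := norm_add_le (f^[n] w - a) a
      rw [sub_add_cancel] at h2
      linarith
  have hz₀ : z₀ ∈ ball z₀ (ρ / 8) := mem_ball_self (by linarith)
  refine mem_fatouSet_of_ball (ρ := ρ / 8 / 2) (by linarith) fun n => ?_
  by_cases hb : ∃ K, ∃ᶠ k in atTop, ‖f^[n k] z₀‖ ≤ K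
  · obtain ⟨K, hK⟩ := hb
    obtain ⟨B, hB⟩ := hbound K
    obtain ⟨ψ, hψ, hψK⟩ := extraction_of_frequently_atTop hK
    obtain ⟨φ, hφ, h, hh⟩ := exists_subseq_tendstoUniformlyOn (g := fun k => f^[n (ψ k)])
      (c := z₀) (ρ := ρ / 8) (B := B) (by linarith) (fun k => (hdn _).differentiableOn)
      fun k z hz => hB _ z₀ hz₀ z hz (hψK k)
    exact ⟨ψ ∘ φ, hψ.comp hφ, Or.inl ⟨h, hh.mono ball_subset_closedBall⟩⟩
  · simp only [not_exists, not_frequently, not_le] at hb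
    refine ⟨id, strictMono_id, Or.inr fun C => ?_⟩
    obtain ⟨B, hB⟩ := hbound C
    filter_upwards [hb B] with k hk z hz
    by_contra! hlt
    exact absurd (hB _ z (ball_subset_ball (by linarith) hz) z₀ hz₀ hlt.le) (not_le.mpr hk)

/-- The blowing-up property of the Julia set. -/
theorem exists_iterate_eq_of_mem_juliaSet (hf : Differentiable ℂ f) {z₀ a b : ℂ}
    (hz : z₀ ∈ juliaSet f) {ρ : ℝ} (hρ : 0 < ρ) (hab : a ≠ b) (N : ℕ) :
    ∃ n ≥ N, ∃ z ∈ ball z₀ ρ, f^[n] z = a ∨ f^[n] z = b := by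
  by_contra! h
  exact hz (mem_fatouSet_of_omits hf hρ hab h)

end Fatou

/-! ### Harnack's inequality and escape in the Fatou set -/

theorem re_le_three_mul_re_of_norm_sub_le {p q : ℂ} (hq : 0 < q.re)
    (h : ‖p - q‖ ≤ 1 / 2 * ‖p + (starRingEnd ℂ) q‖) : p.re ≤ 3 * q.re := by
  have h2 : ‖p - q‖ ^ 2 ≤ (1 / 2 * ‖p + (starRingEnd ℂ) q‖) ^ 2 := by gcongr
  rw [mul_pow, Complex.sq_norm, Complex.sq_norm, Complex.normSq_apply, Complex.normSq_apply] at h2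
  simp only [Complex.sub_re, Complex.sub_im, Complex.add_re, Complex.add_im, Complex.conj_re,
    Complex.conj_im] at h2
  by_contra! hlt
  nlinarith [sq_nonneg (p.im - q.im)]

/-- **Harnack's inequality** for the logarithm of the modulus of a holomorphic function of modulus
greater than one. -/
theorem norm_le_norm_pow_three_of_one_lt_norm {g : ℂ → ℂ} {c w w' : ℂ} {ρ : ℝ}
    (hg : DifferentiableOn ℂ g (ball c ρ)) (h1 : ∀ z ∈ ball c ρ, 1 < ‖g z‖)
    (hw : w ∈ ball c (ρ / 8)) (hw' : w' ∈ ball c (ρ / 8)) : ‖g w'‖ ≤ ‖g w‖ ^ 3 := by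
  have hρ : 0 < ρ := by
    have := dist_nonneg.trans_lt (mem_ball.mp hw)
    linarith
  obtain ⟨L, hLd, hL⟩ := exists_exp_eq_on_ball hg fun z hz =>
    norm_pos_iff.mp (zero_lt_one.trans (h1 z hz))
  have hnorm : ∀ z ∈ ball c ρ, ‖g z‖ = Real.exp (L z).re := fun z hz => by
    rw [← hL z hz, Complex.norm_exp]
  have hre : ∀ z ∈ ball c ρ, 0 < (L z).re := fun z hz => by
    have := h1 z hz
    rwa [hnorm z hz, Real.one_lt_exp_iff] at this
  rw [mem_ball] at hw hw'
  have hsub : ball w (ρ / 2) ⊆ ball c ρ := ball_subset (by linarith)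
  have hwc : w ∈ ball c ρ := by rw [mem_ball]; linarith
  have hwc' : w' ∈ ball c ρ := by rw [mem_ball]; linarith
  have hne : ∀ z ∈ ball c ρ, L z + (starRingEnd ℂ) (L w) ≠ 0 := fun z hz h => by
    have := congrArg Complex.re h
    simp only [Complex.add_re, Complex.conj_re, Complex.zero_re] at this
    linarith [hre z hz, hre w hwc]
  -- The Cayley transform carries the right half-plane to the unit disc and `L w` to 0. Schwarz then
  -- gives |ψ(w')| ≤ 1/2, hence the factor (1 + 1/2)/(1 - 1/2) = 3.
  set ψ : ℂ → ℂ := fun z => (L z - L w) / (L z + (starRingEnd ℂ) (L w)) with hψ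
  have hψw : ψ w = 0 := by simp [hψ]
  have hψd : DifferentiableOn ℂ ψ (ball w (ρ / 2)) :=
    (((hLd.sub_const _).div (hLd.add_const _) hne)).mono hsub
  have hmaps : MapsTo ψ (ball w (ρ / 2)) (closedBall (ψ w) 1) := fun z hz => by
    rw [hψw, mem_closedBall_zero_iff, hψ]
    simp only [norm_div]
    refine div_le_one_of_le₀ ?_ (norm_nonneg _)
    refine le_of_sq_le_sq ?_ (norm_nonneg _)
    rw [Complex.sq_norm, Complex.sq_norm, Complex.normSq_apply, Complex.normSq_apply]
    simp only [Complex.sub_re, Complex.sub_im, Complex.add_re, Complex.add_im, Complex.conj_re,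
      Complex.conj_im]
    nlinarith [mul_pos (hre z (hsub hz)) (hre w hwc)]
  have hdist : dist w' w < ρ / 4 := by linarith [dist_triangle_right w' w c]
  have hS := Complex.dist_le_div_mul_dist_of_mapsTo_ball hψd hmaps
    (show w' ∈ ball w (ρ / 2) by rw [mem_ball]; linarith)
  rw [hψw, dist_zero_right] at hS
  have hhalf : ‖ψ w'‖ ≤ 1 / 2 := hS.trans (by
    rw [div_mul_eq_mul_div, one_mul, div_le_iff₀ (by linarith)]; linarith)
  simp only [hψ, norm_div] at hhalf
  rw [div_le_iff₀ (norm_pos_iff.mpr (hne w' hwc'))] at hhalf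
  have := re_le_three_mul_re_of_norm_sub_le (hre w hwc) hhalf
  rw [hnorm w hwc, hnorm w' hwc', ← Real.exp_nat_mul]
  exact Real.exp_le_exp.mpr (by exact_mod_cast this)

/-- The point `z` escapes to infinity under iteration of `f`. -/
def Escapes (f : ℂ → ℂ) (z : ℂ) : Prop := Tendsto (fun k => ‖f^[k] z‖) atTop atTop

section Harnack

variable {f : ℂ → ℂ}

/-- Escape at one point excludes finite limits, leaving only the alternative ∞ for every
subsequence. -/
theorem IteratesNormalUniformlyOn.eventually_le_norm {s : Set ℂ}
    (h : IteratesNormalUniformlyOn f s) {w : ℂ} (hw : w ∈ s) (he : Escapes f w) (C : ℝ) :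
    ∀ᶠ k in atTop, ∀ z ∈ s, C ≤ ‖f^[k] z‖ := by
  by_contra hcon
  obtain ⟨ψ, hψ, hψC⟩ := extraction_of_frequently_atTop (not_eventually.mp hcon)
  obtain ⟨φ, hφ, ⟨g, hg⟩ | hg⟩ := h ψ
  · exact not_tendsto_nhds_of_tendsto_atTop (he.comp (hψ.comp hφ).tendsto_atTop) _
      (hg.tendsto_at hw).norm
  · obtain ⟨k, hk⟩ := (hg C).exists
    exact hψC _ hk

theorem exists_ball_escapes_of_mem_fatouSet (hf : Differentiable ℂ f) {z₀ : ℂ}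
    (hz : z₀ ∈ fatouSet f) :
    ∃ δ > 0, ∀ w ∈ ball z₀ δ, ∀ w' ∈ ball z₀ δ, Escapes f w →
      Escapes f w' ∧ ∀ᶠ k in atTop, ‖f^[k] w'‖ ≤ ‖f^[k] w‖ ^ 3 := by
  obtain ⟨ρ, hρ, hN⟩ := exists_closedBall_of_mem_fatouSet hz
  have hsub : ball z₀ (ρ / 8) ⊆ closedBall z₀ ρ :=
    ball_subset_closedBall.trans (closedBall_subset_closedBall (by linarith))
  refine ⟨ρ / 8, by linarith, fun w hw w' hw' he => ⟨?_, ?_⟩⟩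
  · exact tendsto_atTop.mpr fun C =>
      (hN.eventually_le_norm (hsub hw) he C).mono fun k hk => hk _ (hsub hw')
  · filter_upwards [hN.eventually_le_norm (hsub hw) he 2] with k hk
    exact norm_le_norm_pow_three_of_one_lt_norm (hf.iterate k).differentiableOn
      (fun z hz => one_lt_two.trans_le (hk z (ball_subset_closedBall hz))) hw hw'

/-- The local cubic comparisons chain along the connected set, their exponents multiplying. -/
theorem exists_pow_bound_of_isPreconnected (hf : Differentiable ℂ f) {P : Set ℂ}
    (hP : IsPreconnected P) (hPF : P ⊆ fatouSet f) {z w : ℂ} (hz : z ∈ P) (hw : w ∈ P)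
    (he : Escapes f z) : ∃ C : ℕ, ∀ᶠ k in atTop, ‖f^[k] w‖ ≤ ‖f^[k] z‖ ^ C := by
  refine (hP.induction₂' (fun x y => Escapes f x →
    Escapes f y ∧ ∃ C : ℕ, ∀ᶠ k in atTop, ‖f^[k] y‖ ≤ ‖f^[k] x‖ ^ C) ?_ ?_ hz hw he).2
  · intro x hx
    obtain ⟨δ, hδ, h⟩ := exists_ball_escapes_of_mem_fatouSet hf (hPF hx)
    filter_upwards [mem_nhdsWithin_of_mem_nhds (ball_mem_nhds x hδ)] with y hy
    have hx' := mem_ball_self (x := x) hδ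
    exact ⟨fun he => ⟨(h x hx' y hy he).1, 3, (h x hx' y hy he).2⟩,
      fun he => ⟨(h y hy x hx' he).1, 3, (h y hy x hx' he).2⟩⟩
  · intro x y z _ _ _ hxy hyz hx
    obtain ⟨hy, C, hC⟩ := hxy hx
    obtain ⟨hz, D, hD⟩ := hyz hy
    refine ⟨hz, C * D, ?_⟩
    filter_upwards [hC, hD] with k h1 h2
    rw [pow_mul]
    exact h2.trans (by gcongr)

theorem escapes_of_mem_fastEscapingSet (hf : Continuous f) {R : ℝ} (hR : IsAdmissibleRadius f R)
    {z : ℂ} (hz : z ∈ fastEscapingSet f R) : Escapes f z := by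
  obtain ⟨L, hL⟩ := hz
  exact (tendsto_add_atTop_iff_nat L).mp (tendsto_atTop_mono hL (hR.tendsto_iterate hf))

theorem mem_fastEscapingSet_of_eventually {R : ℝ} (hR : IsAdmissibleRadius f R) {z : ℂ} (L : ℕ)
    (h : ∀ᶠ n in atTop, (maxModulus f)^[n] R ≤ ‖f^[n + L] z‖) : z ∈ fastEscapingSet f R := by
  obtain ⟨N, hN⟩ := eventually_atTop.mp h
  refine ⟨N + L, fun n => ?_⟩
  rw [← add_assoc]
  exact (hR.strictMono_iterate.monotone (Nat.le_add_right n N)).trans (hN _ (Nat.le_add_left N n))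

theorem iterate_mem_fastEscapingSet_iff {R : ℝ} (hR : IsAdmissibleRadius f R) {z : ℂ} (m : ℕ) :
    f^[m] z ∈ fastEscapingSet f R ↔ z ∈ fastEscapingSet f R := by
  constructor
  · rintro ⟨L, hL⟩
    refine ⟨L + m, fun n => ?_⟩
    rw [← add_assoc, Function.iterate_add_apply]
    exact hL n
  · rintro ⟨L, hL⟩
    refine ⟨L, fun n => ?_⟩
    rw [← Function.iterate_add_apply, add_right_comm]
    exact (hR.strictMono_iterate.monotone (Nat.le_add_right n m)).trans (hL (n + m))

theorem exists_ball_subset_fastEscapingSet_of_mem_fatouSet (hf : IsTranscendentalEntire f) {R : ℝ}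
    (hR : IsAdmissibleRadius f R) {z₀ : ℂ} (hz : z₀ ∈ fatouSet f) :
    ∃ δ > 0, ∀ w ∈ ball z₀ δ, ∀ w' ∈ ball z₀ δ, w ∈ fastEscapingSet f R →
      w' ∈ fastEscapingSet f R := by
  obtain ⟨δ, hδ, h⟩ := exists_ball_escapes_of_mem_fatouSet hf.1 hz
  refine ⟨δ, hδ, fun w hw w' hw' hA => ?_⟩
  have h3 := (h w' hw' w hw
    (h w hw w' hw' (escapes_of_mem_fastEscapingSet hf.1.continuous hR hA)).1).2
  obtain ⟨L, hL⟩ := hA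
  -- The extra iterate pays for the cube: the cube of the n-th radius is at most the next radius.
  refine mem_fastEscapingSet_of_eventually hR (1 + L) ?_
  filter_upwards [(hR.tendsto_iterate hf.1.continuous).eventually
    (hf.eventually_mul_pow_le_maxModulus 1 3),
    (tendsto_add_atTop_nat (1 + L)).eventually h3] with n h1 h2
  rw [← Function.iterate_succ_apply' (maxModulus f), one_mul] at h1
  refine le_of_pow_le_pow_left₀ three_ne_zero (norm_nonneg _) ((h1.trans ?_).trans h2)
  rw [← add_assoc]
  exact hL (n + 1)

end Harnack

/-! ### Annuli covering annuli -/

/-- The closed round annulus of inner radius `r` and outer radius `8 * r`. -/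
def annulus (r : ℝ) : Set ℂ := {z | r ≤ ‖z‖ ∧ ‖z‖ ≤ 8 * r}

theorem isCompact_annulus (r : ℝ) : IsCompact (annulus r) := by
  have h : annulus r = closedBall 0 (8 * r) ∩ {z | r ≤ ‖z‖} := by
    ext z; simp [annulus, and_comm]
  rw [h]
  exact (isCompact_closedBall _ _).inter_right (isClosed_le continuous_const continuous_norm)

theorem isPreconnected_annulus {r : ℝ} (hr : 0 ≤ r) : IsPreconnected (annulus r) := by
  have h : annulus r = (fun p : ℝ × ℝ => (p.1 : ℂ) * Complex.exp (p.2 * Complex.I)) ''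
      (Icc r (8 * r) ×ˢ univ) := by
    ext z
    constructor
    · intro hz
      exact ⟨(‖z‖, z.arg), ⟨hz, mem_univ _⟩, Complex.norm_mul_exp_arg_mul_I z⟩
    · rintro ⟨⟨t, θ⟩, ⟨⟨h1, h2⟩, -⟩, rfl⟩
      have : ‖(t : ℂ) * Complex.exp (θ * Complex.I)‖ = t := by
        rw [norm_mul, Complex.norm_exp_ofReal_mul_I, mul_one, Complex.norm_real,
          Real.norm_of_nonneg (hr.trans h1)]
      exact ⟨this.symm ▸ h1, this.symm ▸ h2⟩
  rw [h]
  exact (isPreconnected_Icc.prod isPreconnected_univ).image _ (by fun_prop)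

theorem annulus_nonempty {r : ℝ} (hr : 0 ≤ r) : (annulus r).Nonempty :=
  ⟨(r : ℂ), by simp only [annulus, mem_ofPred_eq, Complex.norm_real, Real.norm_of_nonneg hr]
               constructor <;> linarith⟩

section Covering

variable {f : ℂ → ℂ}

theorem IsTranscendentalEntire.eventually_exists_annulus_subset_image
    (hf : IsTranscendentalEntire f) :
    ∀ᶠ r in atTop, ∃ S, maxModulus f r ≤ S ∧ annulus S ⊆ f '' annulus r := by
  obtain ⟨C, hC⟩ := schottky_of_omits 2
  have ht : Tendsto (fun r : ℝ => 7 / 2 * r) atTop atTop :=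
    tendsto_id.const_mul_atTop (by norm_num)
  filter_upwards [ht.eventually (hf.eventually_mul_maxModulus_le (κ := 8 / 7) (by norm_num)
    (9 + 136 * max C 0)), ht.eventually (hf.eventually_le_maxModulus 1), eventually_gt_atTop 0]
    with r h1 h2 hr
  rw [show 8 / 7 * (7 / 2 * r) = 4 * r by ring] at h1
  set S := maxModulus f (7 / 2 * r) with hS
  have hrS : maxModulus f r ≤ S := maxModulus_mono hf.1 hr.le (by linarith)
  by_contra! hcon
  obtain ⟨a, ⟨ha1, ha2⟩, ha⟩ := not_subset.mp (hcon S hrS)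
  -- If the annuli at S and 16S are both missed, the omitted values satisfy 8S ≤ |b - a| ≤ 136S.
  -- Schottky on a disc centred at modulus 7r/2 then bounds |f| by a multiple of S at a point of
  -- modulus 4r, against M(4r)/M(7r/2) → ∞.
  obtain ⟨b, ⟨hb1, hb2⟩, hb⟩ := not_subset.mp (hcon (16 * S) (by linarith))
  obtain ⟨z, hz, hfz⟩ := exists_norm_eq_maxModulus hf.1.continuous (r := 4 * r) (by linarith)
  set c : ℂ := (7 / 8 : ℝ) * z with hc
  have hcn : ‖c‖ = 7 / 2 * r := by
    rw [hc, norm_mul, hz, Complex.norm_real]; norm_num; ring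
  have hzc : dist z c = r / 2 := by
    rw [dist_eq_norm, hc, show z - ((7 / 8 : ℝ) : ℂ) * z = ((1 / 8 : ℝ) : ℂ) * z by
      push_cast; ring, norm_mul, hz, Complex.norm_real]
    norm_num; ring
  have hab1 : 8 * S ≤ ‖b - a‖ := by linarith [norm_sub_norm_le b a]
  have hab2 : ‖b - a‖ ≤ 136 * S := by linarith [norm_sub_le b a]
  have hab : a ≠ b := by
    rintro rfl
    rw [sub_self, norm_zero] at hab1
    linarith
  have hsub : ball c (2 * r) ⊆ annulus r := fun w hw => by
    rw [mem_ball, dist_eq_norm] at hw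
    constructor
    · linarith [norm_sub_norm_le c w, norm_sub_rev c w]
    · linarith [norm_sub_norm_le w c]
  have hfc : ‖f c‖ ≤ S := by rw [hS, ← hcn]; exact norm_le_maxModulus hf.1.continuous c
  have key := hC f a b c (2 * r) (by linarith) hab hf.1.differentiableOn
    (fun w hw => ⟨fun h => ha ⟨w, hsub hw, h⟩, fun h => hb ⟨w, hsub hw, h⟩⟩)
    (by linarith [norm_sub_le (f c) a]) z (by rw [mem_ball, hzc]; linarith)
  have h3 : C * ‖b - a‖ ≤ max C 0 * (136 * S) :=
    (mul_le_mul_of_nonneg_right (le_max_left _ _) (norm_nonneg _)).trans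
      (mul_le_mul_of_nonneg_left hab2 (le_max_right _ _))
  have h4 := norm_sub_norm_le (f z) a
  nlinarith

/-- A sequence of radii growing at least like the iterated maximum modulus, such that `f` maps each
annulus over the next one. -/
structure IsAnnularTower (f : ℂ → ℂ) (S : ℕ → ℝ) : Prop where
  pos : ∀ n, 0 < S n
  lt : ∀ n, 8 * S n < S (n + 1)
  maxModulus_le : ∀ n, maxModulus f (S n) ≤ S (n + 1)
  subset : ∀ n, annulus (S (n + 1)) ⊆ f '' annulus (S n)

theorem IsAnnularTower.shift {S : ℕ → ℝ} (hS : IsAnnularTower f S) (m : ℕ) :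
    IsAnnularTower f fun n => S (n + m) where
  pos n := hS.pos _
  lt n := by rw [add_right_comm]; exact hS.lt _
  maxModulus_le n := by rw [add_right_comm]; exact hS.maxModulus_le _
  subset n := by rw [add_right_comm]; exact hS.subset _

theorem IsAnnularTower.strictMono {S : ℕ → ℝ} (hS : IsAnnularTower f S) : StrictMono S :=
  strictMono_nat_of_lt_succ fun n => by linarith [hS.lt n, hS.pos n]

theorem IsAnnularTower.tendsto_atTop {S : ℕ → ℝ} (hS : IsAnnularTower f S) :
    Tendsto S atTop atTop := by
  have h : ∀ n : ℕ, n * S 0 ≤ S n := fun n => by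
    induction n with
    | zero => simpa using (hS.pos 0).le
    | succ n ih =>
      have := hS.strictMono.monotone (Nat.zero_le n)
      push_cast
      linarith [hS.lt n, hS.pos 0]
  exact tendsto_atTop_mono h (tendsto_natCast_atTop_atTop.atTop_mul_const (hS.pos 0))

theorem IsTranscendentalEntire.exists_isAnnularTower (hf : IsTranscendentalEntire f) (R : ℝ) :
    ∃ S, IsAnnularTower f S ∧ R ≤ S 0 := by
  obtain ⟨r₀, h₀⟩ := eventually_atTop.mp (hf.eventually_exists_annulus_subset_image.and
    ((hf.eventually_mul_pow_le_maxModulus 9 1).and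
      ((eventually_gt_atTop 0).and (eventually_ge_atTop R))))
  have hnext : ∀ r, ∃ S, r₀ ≤ r → maxModulus f r ≤ S ∧ annulus S ⊆ f '' annulus r := fun r => by
    by_cases hr : r₀ ≤ r
    · obtain ⟨S, hS⟩ := (h₀ r hr).1
      exact ⟨S, fun _ => hS⟩
    · exact ⟨0, fun h => absurd h hr⟩
  choose g hg using hnext
  have hgrow : ∀ r, r₀ ≤ r → 9 * r ≤ g r := fun r hr => by
    have := (h₀ r hr).2.1
    rw [pow_one] at this
    exact this.trans (hg r hr).1
  have hge : ∀ n, r₀ ≤ g^[n] r₀ := fun n => by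
    induction n with
    | zero => exact le_rfl
    | succ n ih =>
      rw [Function.iterate_succ_apply']
      linarith [hgrow _ ih, (h₀ _ ih).2.2.1]
  refine ⟨fun n => g^[n] r₀, ⟨fun n => (h₀ _ (hge n)).2.2.1, fun n => ?_, fun n => ?_,
    fun n => ?_⟩, (h₀ r₀ le_rfl).2.2.2⟩
  · rw [Function.iterate_succ_apply']
    linarith [hgrow _ (hge n), (h₀ _ (hge n)).2.2.1]
  · rw [Function.iterate_succ_apply']; exact (hg _ (hge n)).1
  · rw [Function.iterate_succ_apply']; exact (hg _ (hge n)).2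

/-- Points whose first n iterates follow the itinerary form nested compact sets, nonempty by pulling
back along the coverings. -/
theorem exists_forall_iterate_mem {X : ℕ → Set ℂ} (hf : Continuous f)
    (hX : ∀ n, IsCompact (X n)) (hne : ∀ n, (X n).Nonempty)
    (hsub : ∀ n, X (n + 1) ⊆ f '' X n) : ∃ z, ∀ n, f^[n] z ∈ X n := by
  let K : ℕ → Set ℂ := fun n => ⋂ j ∈ Iic n, f^[j] ⁻¹' X j
  have hclosed : ∀ n, IsClosed (K n) := fun n =>
    isClosed_biInter fun j _ => (hX j).isClosed.preimage (hf.iterate j)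
  have hpull : ∀ n, ∀ y ∈ X n, ∃ z ∈ K n, f^[n] z = y := by
    intro n
    induction n with
    | zero =>
      intro y hy
      refine ⟨y, ?_, rfl⟩
      simpa [K] using hy
    | succ n ih =>
      intro y hy
      obtain ⟨x, hx, rfl⟩ := hsub n hy
      obtain ⟨z, hz, rfl⟩ := ih x hx
      refine ⟨z, ?_, Function.iterate_succ_apply' f n z⟩
      simp only [K, mem_iInter] at hz ⊢
      intro j hj
      rcases Nat.le_succ_iff.mp hj with h | rfl
      · exact hz j h
      · rw [mem_preimage, Function.iterate_succ_apply']; exact hy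
  have hK0 : K 0 ⊆ X 0 := fun z hz => by simpa [K] using hz
  obtain ⟨z, hz⟩ := IsCompact.nonempty_iInter_of_sequence_nonempty_isCompact_isClosed K
    (fun n => biInter_subset_biInter_left (Iic_subset_Iic.mpr n.le_succ))
    (fun n => by
      obtain ⟨y, hy⟩ := hne n
      obtain ⟨z, hz, -⟩ := hpull n y hy
      exact ⟨z, hz⟩)
    ((hX 0).of_isClosed_subset (hclosed 0) hK0) hclosed
  refine ⟨z, fun n => ?_⟩
  have := mem_iInter.mp hz n
  simp only [K, mem_iInter] at this
  exact this n (mem_Iic.mpr le_rfl)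

end Covering

/-! ### Fast escaping points and the Julia set -/

section JuliaSet

variable {f : ℂ → ℂ}

theorem IsAnnularTower.escapes {S : ℕ → ℝ} (hS : IsAnnularTower f S) {z : ℂ} (hz : ∀ n, S n ≤ ‖f^[n] z‖) : Escapes f z :=
  tendsto_atTop_mono hz hS.tendsto_atTop

/-- Two consecutive points of an orbit going up an annular tower lie in different components of the
Fatou set. -/
theorem IsAnnularTower.not_subset_fatouSet {S : ℕ → ℝ} (hf : IsTranscendentalEntire f)
    (hS : IsAnnularTower f S) {z : ℂ} (hz : ∀ n, f^[n] z ∈ annulus (S n)) {P : Set ℂ}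
    (hP : IsPreconnected P) (n : ℕ) (h1 : f^[n] z ∈ P) (h2 : f^[n + 1] z ∈ P) :
    ¬ P ⊆ fatouSet f := by
  intro hPF
  have he : Escapes f (f^[n] z) := by
    have := (tendsto_add_atTop_iff_nat n).mpr (hS.escapes fun n => (hz n).1)
    simpa only [Escapes, Function.iterate_add_apply] using this
  obtain ⟨C, hC⟩ := exists_pow_bound_of_isPreconnected hf.1 hP hPF h1 h2 he
  -- Comparability up to a fixed power `C` fails because M(S) eventually exceeds (8S)^C.
  obtain ⟨k, h3, h4⟩ := (hC.and (((tendsto_add_atTop_iff_nat n).mpr hS.tendsto_atTop).eventually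
    (hf.eventually_mul_pow_le_maxModulus (8 ^ C + 1) C))).exists
  rw [← Function.iterate_add_apply, ← Function.iterate_add_apply, ← add_assoc] at h3
  have h5 := (hS.maxModulus_le (k + n)).trans (hz (k + n + 1)).1
  have h6 : ‖f^[k + n] z‖ ^ C ≤ (8 * S (k + n)) ^ C := by gcongr; exact (hz (k + n)).2
  have h7 : 0 < S (k + n) ^ C := pow_pos (hS.pos _) C
  rw [mul_pow] at h6
  linarith

theorem not_mem_fatouSet_of_mem_frontier_component {z p : ℂ}
    (hp : p ∈ frontier (connectedComponentIn (fatouSet f) z)) : p ∉ fatouSet f := by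
  intro hpF
  have hopen := (isOpen_fatouSet f).connectedComponentIn (x := p)
  obtain ⟨y, hy1, hy2⟩ := mem_closure_iff.mp hp.1 _ hopen (mem_connectedComponentIn hpF)
  have heq := (connectedComponentIn_eq hy1).trans (connectedComponentIn_eq hy2).symm
  exact hp.2 (heq ▸ hopen.interior_eq.symm ▸ mem_connectedComponentIn hpF)

theorem IsAnnularTower.exists_mem_of_subset_fatouSet {S : ℕ → ℝ} {R : ℝ}
    (hf : IsTranscendentalEntire f) (hR : IsAdmissibleRadius f R) (hS : IsAnnularTower f S)
    (hRS : R ≤ S 0) (h0 : annulus (S 0) ⊆ fatouSet f) :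
    (fastEscapingSet f R ∩ juliaSet f).Nonempty := by
  obtain ⟨z, hz⟩ := exists_forall_iterate_mem hf.1.continuous (fun n => isCompact_annulus (S n))
    (fun n => annulus_nonempty (hS.pos n).le) hS.subset
  have hF : ∀ n, annulus (S n) ⊆ fatouSet f := fun n => by
    induction n with
    | zero => exact h0
    | succ n ih =>
      intro y hy
      obtain ⟨x, hx, rfl⟩ := hS.subset n hy
      exact apply_mem_fatouSet hf (ih hx)
  have hzF : z ∈ fatouSet f := h0 (hz 0)
  set H := connectedComponentIn (fatouSet f) z with hH
  have hHF : H ⊆ fatouSet f := connectedComponentIn_subset _ _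
  have hzH : z ∈ H := mem_connectedComponentIn hzF
  have hHc : IsPreconnected H := isPreconnected_connectedComponentIn
  -- If the image of `H` dipped below this modulus, it would meet the annulus at `S n`. Their union
  -- would be a connected part of the Fatou set containing two consecutive orbit points. The bound
  -- passes to the closure of `H`, so boundary points escape fast with `L = 1`.
  have hbig : ∀ n, ∀ y ∈ H, 8 * S n ≤ ‖f^[n + 1] y‖ := by
    intro n y hy
    by_contra! hlt
    have hcont : Continuous f^[n + 1] := hf.1.continuous.iterate _
    obtain ⟨x, hx, hxn⟩ := hHc.intermediate_value hy hzH hcont.norm.continuousOn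
      (show 8 * S n ∈ Icc ‖f^[n + 1] y‖ ‖f^[n + 1] z‖ from
        ⟨hlt.le, (hS.lt n).le.trans (hz (n + 1)).1⟩)
    replace hxn : ‖f^[n + 1] x‖ = 8 * S n := hxn
    have hxA : f^[n + 1] x ∈ annulus (S n) :=
      ⟨by rw [hxn]; linarith [hS.pos n], hxn.le⟩
    refine hS.not_subset_fatouSet hf hz (IsPreconnected.union _ hxA (mem_image_of_mem _ hx)
      (isPreconnected_annulus (hS.pos n).le) (hHc.image _ hcont.continuousOn)) n
      (Or.inl (hz n)) (Or.inr (mem_image_of_mem _ hzH)) (union_subset (hF n) ?_)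
    rintro _ ⟨w, hw, rfl⟩
    exact (iterate_mem_fatouSet_iff hf _).mpr (hHF hw)
  have hne : (frontier H).Nonempty := by
    rw [nonempty_frontier_iff]
    refine ⟨⟨z, hzH⟩, fun huniv => ?_⟩
    exact hS.not_subset_fatouSet hf hz hHc 0 hzH (huniv ▸ mem_univ _) hHF
  obtain ⟨p, hp⟩ := hne
  refine ⟨p, ⟨1, fun n => ?_⟩, not_mem_fatouSet_of_mem_frontier_component hp⟩
  have h1 : 8 * S n ≤ ‖f^[n + 1] p‖ :=
    closure_minimal (s := H) (t := {y | 8 * S n ≤ ‖f^[n + 1] y‖}) (hbig n)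
      (isClosed_le continuous_const (hf.1.continuous.iterate _).norm) hp.1
  linarith [iterate_maxModulus_le hf.1 hR hRS hS.maxModulus_le n, hS.pos n]

/-- The Julia set contains fast escaping points. -/
theorem nonempty_fastEscapingSet_inter_juliaSet {R : ℝ} (hf : IsTranscendentalEntire f)
    (hR : IsAdmissibleRadius f R) : (fastEscapingSet f R ∩ juliaSet f).Nonempty := by
  obtain ⟨S, hS, hRS⟩ := hf.exists_isAnnularTower R
  by_cases h : ∃ n, annulus (S n) ⊆ fatouSet f
  · obtain ⟨n, hn⟩ := h
    exact (hS.shift n).exists_mem_of_subset_fatouSet hf hR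
      (hRS.trans (hS.strictMono.monotone (Nat.zero_le _))) (by simpa using hn)
  · simp only [not_exists, not_subset] at h
    obtain ⟨z, hz⟩ := exists_forall_iterate_mem (X := fun n => annulus (S n) ∩ juliaSet f)
      hf.1.continuous (fun n => (isCompact_annulus (S n)).inter_right (isClosed_juliaSet f)) h
      (fun n => by
        rintro y ⟨hy, hyJ⟩
        obtain ⟨x, hx, rfl⟩ := hS.subset n hy
        exact ⟨x, ⟨hx, (iterate_mem_juliaSet_iff hf 1).mp hyJ⟩, rfl⟩)
    exact ⟨z, ⟨0, fun n => (iterate_maxModulus_le hf.1 hR hRS hS.maxModulus_le n).trans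
      (hz n).1.1⟩, (hz 0).2⟩

theorem exists_ne_mem_fastEscapingSet_inter_juliaSet {R : ℝ} (hf : IsTranscendentalEntire f)
    (hR : IsAdmissibleRadius f R) :
    ∃ a ∈ fastEscapingSet f R ∩ juliaSet f, ∃ b ∈ fastEscapingSet f R ∩ juliaSet f, a ≠ b := by
  obtain ⟨p, hpA, hpJ⟩ := nonempty_fastEscapingSet_inter_juliaSet hf hR
  refine ⟨p, ⟨hpA, hpJ⟩, f p, ⟨(iterate_mem_fastEscapingSet_iff hR 1).mpr hpA,
    (iterate_mem_juliaSet_iff hf 1).mpr hpJ⟩, fun h => ?_⟩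
  have he := escapes_of_mem_fastEscapingSet hf.1.continuous hR hpA
  have hfix : ∀ k, f^[k] p = p := fun k => Function.iterate_fixed h.symm k
  simp only [Escapes, hfix] at he
  exact not_tendsto_const_atTop _ _ he

theorem juliaSet_subset_closure {R : ℝ} (hf : IsTranscendentalEntire f)
    (hR : IsAdmissibleRadius f R) :
    juliaSet f ⊆ closure (fastEscapingSet f R ∩ juliaSet f) := by
  intro z hz
  obtain ⟨a, ha, b, hb, hab⟩ := exists_ne_mem_fastEscapingSet_inter_juliaSet hf hR
  refine Metric.mem_closure_iff.mpr fun ε hε => ?_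
  obtain ⟨n, -, w, hw, h⟩ := exists_iterate_eq_of_mem_juliaSet hf.1 hz hε hab 0
  have : f^[n] w ∈ fastEscapingSet f R ∩ juliaSet f := by
    rcases h with h | h <;> rwa [h]
  exact ⟨w, ⟨(iterate_mem_fastEscapingSet_iff hR n).mp this.1,
    (iterate_mem_juliaSet_iff hf n).mp this.2⟩, by rwa [dist_comm]⟩

theorem disjoint_juliaSet_interior_fastEscapingSet {R : ℝ} (hf : IsTranscendentalEntire f)
    (hR : IsAdmissibleRadius f R) : Disjoint (juliaSet f) (interior (fastEscapingSet f R)) := by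
  rw [Set.disjoint_left]
  intro z hzJ hzA
  obtain ⟨ρ, hρ, hsub⟩ := nhds_basis_closedBall.mem_iff.mp (mem_interior_iff_mem_nhds.mp hzA)
  set s := closure (juliaSet f ∩ ball z ρ) with hs
  have hsball : s ⊆ closedBall z ρ :=
    closure_minimal (inter_subset_right.trans ball_subset_closedBall) isClosed_closedBall
  have hcs : CompactSpace s := isCompact_iff_compactSpace.mp
    ((isCompact_closedBall z ρ).of_isClosed_subset isClosed_closure hsball)
  have hzs : z ∈ s := subset_closure ⟨hzJ, mem_ball_self hρ⟩
  have hns : Nonempty s := ⟨⟨z, hzs⟩⟩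
  let E : ℕ → Set ℂ := fun L => {w | ∀ n, (maxModulus f)^[n] R ≤ ‖f^[n + L] w‖}
  have hE : ∀ L, IsClosed (E L) := fun L => by
    simp only [E, ofPred_forall]
    exact isClosed_iInter fun n => isClosed_le continuous_const (hf.1.continuous.iterate _).norm
  -- Baire on the compact set `s` gives one `L` valid on a relatively open piece.
  obtain ⟨L, ⟨x, hx⟩, hxint⟩ := nonempty_interior_of_iUnion_of_closed
    (f := fun L => ((↑) : s → ℂ) ⁻¹' E L) (fun L => (hE L).preimage continuous_subtype_val)
    (by
      refine eq_univ_of_forall fun w => ?_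
      obtain ⟨L, hL⟩ := hsub (hsball w.2)
      exact mem_iUnion.mpr ⟨L, hL⟩)
  obtain ⟨V, hV, hVE⟩ := mem_nhds_subtype s ⟨x, hx⟩ _ |>.mp (mem_interior_iff_mem_nhds.mp hxint)
  obtain ⟨O, hOV, hO, hxO⟩ := _root_.mem_nhds_iff.mp hV
  obtain ⟨y, hyO, hyJ, hyb⟩ := mem_closure_iff.mp hx O hO hxO
  obtain ⟨δ, hδ, hball⟩ := Metric.mem_nhds_iff.mp ((hO.inter isOpen_ball).mem_nhds ⟨hyO, hyb⟩)
  obtain ⟨a, ha, b, hb, hab⟩ := exists_ne_mem_fastEscapingSet_inter_juliaSet hf hR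
  obtain ⟨N, hN⟩ := eventually_atTop.mp ((hR.tendsto_iterate hf.1.continuous).eventually
    (eventually_gt_atTop (max ‖a‖ ‖b‖)))
  obtain ⟨n, hn, w, hw, h⟩ := exists_iterate_eq_of_mem_juliaSet hf.1 hyJ hδ hab (N + L)
  have hwJ : w ∈ juliaSet f := by
    rw [← iterate_mem_juliaSet_iff hf n]
    rcases h with h | h <;> rw [h]
    exacts [ha.2, hb.2]
  have hwE : w ∈ E L := @hVE ⟨w, subset_closure ⟨hwJ, (hball hw).2⟩⟩ (hOV (hball hw).1)
  have h1 := hwE (n - L)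
  rw [Nat.sub_add_cancel (by omega)] at h1
  have h2 := hN (n - L) (by omega)
  have h3 : ‖f^[n] w‖ ≤ max ‖a‖ ‖b‖ := by
    rcases h with h | h <;> rw [h]
    exacts [le_max_left _ _, le_max_right _ _]
  linarith

/-- Around a Fatou point a small disc lies wholly inside or wholly outside A(f). -/
theorem frontier_fastEscapingSet_subset {R : ℝ} (hf : IsTranscendentalEntire f)
    (hR : IsAdmissibleRadius f R) : frontier (fastEscapingSet f R) ⊆ juliaSet f := by
  intro p hp hpF
  obtain ⟨δ, hδ, h⟩ := exists_ball_subset_fastEscapingSet_of_mem_fatouSet hf hR hpF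
  obtain ⟨w, hwb, hwA⟩ := mem_closure_iff.mp hp.1 _ isOpen_ball (mem_ball_self hδ)
  exact hp.2 (mem_interior.mpr ⟨_, fun v hv => h w hwb v hv hwA, isOpen_ball, mem_ball_self hδ⟩)

end JuliaSet

end EntireDynamics

theorem theorem5p1 (f : ℂ → ℂ) (hf : EntireDynamics.IsTranscendentalEntire f) :
    (∃ R : ℝ, EntireDynamics.IsAdmissibleRadius f R) ∧
    ∀ R : ℝ, EntireDynamics.IsAdmissibleRadius f R →
      (EntireDynamics.fastEscapingSet f R ∩ EntireDynamics.juliaSet f).Nonempty ∧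
      EntireDynamics.juliaSet f = frontier (EntireDynamics.fastEscapingSet f R) ∧
      EntireDynamics.juliaSet f =
        closure (EntireDynamics.fastEscapingSet f R ∩ EntireDynamics.juliaSet f) := by
  refine ⟨hf.exists_isAdmissibleRadius, fun R hR => ?_⟩
  have hsub := EntireDynamics.juliaSet_subset_closure hf hR
  refine ⟨EntireDynamics.nonempty_fastEscapingSet_inter_juliaSet hf hR,
    Set.Subset.antisymm (fun z hz => ?_) (EntireDynamics.frontier_fastEscapingSet_subset hf hR),
    hsub.antisymm (closure_minimal Set.inter_subset_right (EntireDynamics.isClosed_juliaSet f))⟩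
  exact ⟨closure_mono Set.inter_subset_left (hsub hz),
    Set.disjoint_left.mp (EntireDynamics.disjoint_juliaSet_interior_fastEscapingSet hf hR) hz⟩
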